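/- **Theorem 1.1 (Main Theorem).** Let $S_n$ be the set of permutations $\pi=\pi_1\cdots\pi_n$ of $\{1,\ldots,n\}$. A *run* of $\pi$ is a maximal consecutive increasing subsequence of $\pi$, and $\mathsf{runsort}(\pi)\in S_n$ is obtained from $\pi$ by sorting its runs so that their smallest entries appear in increasing order (equivalently, sorting the runs lexicographically). For $\sigma\in S_n$, let $\gamma_\sigma$ be the measure on $[0,1]^2$ with density $n$ on $\bigcup_{i=1}^n\left[\frac{i-1}n,\frac in\right)\times\left[\frac{\sigma_i-1}n,\frac{\sigma_i}n\right)$ and density $0$ elsewhere. For measures $\gamma_1,\gamma_2$ on $[0,1]^2$, let $d_\square(\gamma_1,\gamma_2)=\sup_B|\gamma_1(B)-\gamma_2(B)|$, where $B$ ranges over the axis-parallel rectangles $[x_1,x_2]\times[y_1,y_2]\subseteq[0,1]^2$. Let $\mathbf R$ be the measure on $[0,1]^2$ given for measurable $B\subseteq[0,1]^2$ by $$\mathbf R(B)=\int_{B\cap\mathcal C^+}e^{y-1}\,dx\,dy+\int_{\{y\in[0,1]:\,(ye^{1-y},\,y)\in B\}}(1-y)\,dy,\qquad \mathcal C^+=\{(x,y)\in[0,1]^2:x<ye^{1-y}\};$$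 that is, $\mathbf R$ has density $e^{y-1}$ on the region above the curve $\mathcal C=\{(x,y)\in[0,1]^2:x=ye^{1-y}\}$, plus singular mass $(1-y)\,dy$ on $\mathcal C$. Let $\pi^{(n)}$ be chosen uniformly at random from $S_n$. Then for every $\varepsilon>0$, $$\Pr\left[d_\square\left(\gamma_{\mathsf{runsort}(\pi^{(n)})},\mathbf R\right)<\varepsilon\right]\longrightarrow 1\qquad(n\to\infty).$$ Moreover, $\mathbf R$ is a permuton, i.e. a probability measure on $[0,1]^2$ with uniform marginals, $\mathbf R([a,b]\times[0,1])=\mathbf R([0,1]\times[a,b])=b-a$ for all $0\le a\le b\le1$, and its support is $\{(x,y)\in[0,1]^2:x\le ye^{1-y}\}$. -/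

import Mathlib

open MeasureTheory Set Filter Topology

/-- The positions `j` lying in the same ascending run of `π` as the position `i`: the entries of `π`
increase along all consecutive positions between `i` and `j`. -/
def run {n : ℕ} (π : Equiv.Perm (Fin n)) (i : Fin n) : Finset (Fin n) :=
  {j | ∀ k l : Fin n, min i j ≤ k → k < l → l ≤ max i j → π k < π l}

theorem mem_run_self {n : ℕ} (π : Equiv.Perm (Fin n)) (i : Fin n) : i ∈ run π i := by
  simp only [run, Finset.mem_filter, Finset.mem_univ, true_and, min_self, max_self]
  intro k l hk hkl hl
  exact absurd (hk.trans_lt (hkl.trans_le hl)) (lt_irrefl _)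

/-- The smallest entry of the ascending run of `π` containing the position `i`. -/
def runMin {n : ℕ} (π : Equiv.Perm (Fin n)) (i : Fin n) : Fin n :=
  (run π i).inf' ⟨i, mem_run_self π i⟩ π

/-- `runsort π` sorts the ascending runs of `π` so that their smallest entries increase, keeping
the order inside each run (`Tuple.sort` is the stable sort: positions with the same key keep
their order). The entry of `runsort π` in position `k` is `π (Tuple.sort (runMin π) k)`. -/
def runsort {n : ℕ} (π : Equiv.Perm (Fin n)) : Equiv.Perm (Fin n) :=
  π * Tuple.sort (runMin π)

/-- The grid square of side `1/n` whose upper right corner is the point of the scaled plot of `σ`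
belonging to position `i`. Positions and entries are numbered from `0`. -/
def plotCell {n : ℕ} (σ : Equiv.Perm (Fin n)) (i : Fin n) : Set (ℝ × ℝ) :=
  Ico ((i : ℝ) / n) (((i : ℝ) + 1) / n) ×ˢ Ico (((σ i : ℕ) : ℝ) / n) ((((σ i : ℕ) : ℝ) + 1) / n)

/-- The measure of a permutation `σ` of size `n`: density `n` on the squares of its scaled plot,
and density `0` elsewhere. -/
noncomputable def permMeasure {n : ℕ} (σ : Equiv.Perm (Fin n)) : Measure (ℝ × ℝ) :=
  (volume.restrict (⋃ i, plotCell σ i)).withDensity (fun _ => (n : ENNReal))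

/-- The distance `d_□`: the supremum of `|γ₁ B - γ₂ B|` over the axis-parallel rectangles `B`
in the unit square. The set of values is bounded when both measures are finite. -/
noncomputable def rectDist (γ₁ γ₂ : Measure (ℝ × ℝ)) : ℝ :=
  sSup {r : ℝ | ∃ x₁ x₂ y₁ y₂ : ℝ, 0 ≤ x₁ ∧ x₁ ≤ x₂ ∧ x₂ ≤ 1 ∧ 0 ≤ y₁ ∧ y₁ ≤ y₂ ∧ y₂ ≤ 1 ∧
    r = |γ₁.real (Icc x₁ x₂ ×ˢ Icc y₁ y₂) - γ₂.real (Icc x₁ x₂ ×ˢ Icc y₁ y₂)|}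

/-- A permuton: a probability measure carried by the unit square, with uniform marginals. -/
structure IsPermuton (γ : Measure (ℝ × ℝ)) : Prop where
  isProbabilityMeasure : IsProbabilityMeasure γ
  outside : γ (Icc (0 : ℝ) 1 ×ˢ Icc (0 : ℝ) 1)ᶜ = 0
  marginal_fst : ∀ a b : ℝ, 0 ≤ a → a ≤ b → b ≤ 1 →
    γ (Icc a b ×ˢ Icc (0 : ℝ) 1) = ENNReal.ofReal (b - a)
  marginal_snd : ∀ a b : ℝ, 0 ≤ a → a ≤ b → b ≤ 1 →
    γ (Icc (0 : ℝ) 1 ×ˢ Icc a b) = ENNReal.ofReal (b - a)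

/-- The region of the unit square above the curve `x = y e ^ (1 - y)`. -/
def aboveCurve : Set (ℝ × ℝ) :=
  {p | p ∈ Icc (0 : ℝ) 1 ×ˢ Icc (0 : ℝ) 1 ∧ p.1 < p.2 * Real.exp (1 - p.2)}

/-- The runsort permuton: density `e ^ (y - 1)` on the region above the curve
`x = y e ^ (1 - y)`, plus the mass `(1 - y) dy` on the curve, parametrized by `y ∈ [0, 1]`. -/
noncomputable def runsortPermuton : Measure (ℝ × ℝ) :=
  (volume.restrict aboveCurve).withDensity (fun p => ENNReal.ofReal (Real.exp (p.2 - 1))) +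
  ((volume.restrict (Icc (0 : ℝ) 1)).withDensity (fun y => ENNReal.ofReal (1 - y))).map
    (fun y : ℝ => (y * Real.exp (1 - y), y))

/-!
Follow a position leftwards to the first entry below `s n`. A second moment computation over the
windows of `k + 1` consecutive positions shows that the number of entries below `y n` reached by
climbing `k` steps from an entry below `s n` through entries in `[s n, y n)` concentrates at
`n s (y - s) ^ k / k!`. Summing over `k`, the number of entries below `y n` lying in runs with
minimum below `s n` concentrates at `n s e ^ (y - s)`. Sorting the runs moves the entries of these
runs to an initial segment of positions, of relative length `s e ^ (1 - s)` (the case `y = 1`).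
Hence the joint distribution function of `runsort π` at the point `(s e ^ (1 - s), y)` tends to
`s e ^ (y - s)`, which is its value for the runsort permuton. Measures with uniform marginals have
`1`-Lipschitz distribution functions, so pointwise convergence of these on a finite grid controls
`rectDist`.
-/

open scoped BigOperators Finset

theorem toOuterMeasure_uniformOfFintype_eq_expect {Ω : Type*} [Fintype Ω] [Nonempty Ω]
    (s : Set Ω) :
    (PMF.uniformOfFintype Ω).toOuterMeasure s = ENNReal.ofReal (𝔼 ω, s.indicator 1 ω) := by
  classical
  rw [PMF.toOuterMeasure_uniformOfFintype_apply, Fintype.expect_eq_sum_div_card,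
    ENNReal.ofReal_div_of_pos (by positivity), ENNReal.ofReal_natCast]
  simp only [indicator_apply, Pi.one_apply, Finset.sum_boole, ENNReal.ofReal_natCast]
  rw [Fintype.card_subtype]

section TendstoInMean

variable {Ω : ℕ → Type*} [∀ n, Fintype (Ω n)]

/-- Convergence in mean to a constant, for real random variables `X n` on finite probability spaces
`Ω n` carrying the uniform distribution. -/
def TendstoInMean (X : ∀ n, Ω n → ℝ) (c : ℝ) : Prop :=
  Tendsto (fun n => 𝔼 ω, |X n ω - c|) atTop (𝓝 0)

namespace TendstoInMean

variable {X Y : ∀ n, Ω n → ℝ} {c d : ℝ}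

theorem squeeze (hY : TendstoInMean Y 0) (h : ∀ᶠ n in atTop, ∀ ω, |X n ω - c| ≤ Y n ω) :
    TendstoInMean X c := by
  refine squeeze_zero' (Eventually.of_forall fun n => Finset.expect_nonneg fun ω _ => abs_nonneg _)
    ?_ hY
  filter_upwards [h] with n hn
  refine Finset.expect_le_expect fun ω _ => (hn ω).trans ?_
  rw [sub_zero]
  exact le_abs_self _

theorem of_tendsto [∀ n, Nonempty (Ω n)] {a : ℕ → ℝ} (h : Tendsto a atTop (𝓝 c)) :
    TendstoInMean (fun n (_ : Ω n) => a n) c := by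
  simp only [TendstoInMean, Fintype.expect_const]
  simpa using (h.sub_const c).abs

theorem abs_sub (hX : TendstoInMean X c) : TendstoInMean (fun n ω => |X n ω - c|) 0 := by
  simpa only [TendstoInMean, sub_zero, abs_abs] using hX

theorem add (hX : TendstoInMean X c) (hY : TendstoInMean Y d) :
    TendstoInMean (fun n ω => X n ω + Y n ω) (c + d) := by
  refine squeeze_zero (fun n => Finset.expect_nonneg fun ω _ => abs_nonneg _) (fun n => ?_)
    (by simpa using Tendsto.add hX hY)
  rw [← Finset.expect_add_distrib]
  refine Finset.expect_le_expect fun ω _ => ?_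
  rw [add_sub_add_comm]
  exact abs_add_le _ _

theorem const_mul (hX : TendstoInMean X c) (a : ℝ) :
    TendstoInMean (fun n ω => a * X n ω) (a * c) := by
  simp only [TendstoInMean, ← mul_sub, abs_mul, ← Finset.mul_expect]
  simpa using Tendsto.const_mul |a| hX

theorem sum {ι : Type*} {Z : ι → ∀ n, Ω n → ℝ} {e : ι → ℝ} (t : Finset ι)
    (h : ∀ i ∈ t, TendstoInMean (Z i) (e i)) :
    TendstoInMean (fun n ω => ∑ i ∈ t, Z i n ω) (∑ i ∈ t, e i) := by
  classical
  induction t using Finset.induction_on with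
  | empty => simp [TendstoInMean]
  | insert i t hi ih =>
    simp only [Finset.sum_insert hi]
    exact (h i (by simp)).add (ih fun j hj => h j (by simp [hj]))

theorem of_sandwich [∀ n, Nonempty (Ω n)] {L U : ℕ → ∀ n, Ω n → ℝ} {l u : ℕ → ℝ}
    (hL : ∀ K, TendstoInMean (L K) (l K)) (hU : ∀ K, TendstoInMean (U K) (u K))
    (hl : Tendsto l atTop (𝓝 c)) (hu : Tendsto u atTop (𝓝 c))
    (hLX : ∀ K, ∀ᶠ n in atTop, ∀ ω, L K n ω ≤ X n ω)
    (hXU : ∀ K, ∀ᶠ n in atTop, ∀ ω, X n ω ≤ U K n ω) :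
    TendstoInMean X c := by
  have hbound {K n : ℕ} {ω : Ω n} (hL : L K n ω ≤ X n ω) (hU : X n ω ≤ U K n ω) :
      |X n ω - c| ≤ |L K n ω - l K| + |U K n ω - u K| + (|l K - c| + |u K - c|) := by
    rw [abs_le]
    constructor <;> linarith [neg_abs_le (L K n ω - l K), le_abs_self (U K n ω - u K),
      neg_abs_le (l K - c), le_abs_self (u K - c), abs_nonneg (L K n ω - l K),
      abs_nonneg (U K n ω - u K), abs_nonneg (l K - c), abs_nonneg (u K - c)]
  have herr : Tendsto (fun K => |l K - c| + |u K - c|) atTop (𝓝 0) := by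
    simpa using (hl.sub_const c).abs.add (hu.sub_const c).abs
  refine tendsto_order.2 ⟨fun a ha => Eventually.of_forall fun n =>
    ha.trans_le (Finset.expect_nonneg fun ω _ => abs_nonneg _), fun ε hε => ?_⟩
  obtain ⟨K, hK⟩ := (herr.eventually_lt_const (half_pos hε)).exists
  have hLU : Tendsto (fun n => 𝔼 ω, (|L K n ω - l K| + |U K n ω - u K|)) atTop (𝓝 0) := by
    simpa only [Finset.expect_add_distrib, add_zero] using Tendsto.add (hL K) (hU K)
  filter_upwards [hLU.eventually_lt_const (half_pos hε), hLX K, hXU K] with n hn hLn hUn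
  calc 𝔼 ω, |X n ω - c|
      ≤ 𝔼 ω, (|L K n ω - l K| + |U K n ω - u K| + (|l K - c| + |u K - c|)) :=
        Finset.expect_le_expect fun ω _ => hbound (hLn ω) (hUn ω)
    _ = 𝔼 ω, (|L K n ω - l K| + |U K n ω - u K|) + (|l K - c| + |u K - c|) := by
        rw [Finset.expect_add_distrib, Fintype.expect_const]
    _ < ε / 2 + ε / 2 := add_lt_add hn hK
    _ = ε := add_halves ε

theorem of_expect_sq (h : Tendsto (fun n => 𝔼 ω, (X n ω - c) ^ 2) atTop (𝓝 0)) :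
    TendstoInMean X c := by
  refine squeeze_zero (fun n => Finset.expect_nonneg fun ω _ => abs_nonneg _) (fun n => ?_)
    (by simpa using h.sqrt)
  have hcs := Finset.expect_mul_sq_le_sq_mul_sq Finset.univ (fun ω => |X n ω - c|) fun _ => 1
  refine Real.le_sqrt_of_sq_le ?_
  simp only [mul_one, sq_abs, one_pow] at hcs
  refine hcs.trans (mul_le_of_le_one_right (Finset.expect_nonneg fun ω _ => sq_nonneg _) ?_)
  rcases isEmpty_or_nonempty (Ω n) with hΩ | hΩ
  · simp
  · rw [Fintype.expect_const]

/-- The variance `𝔼 X² - (𝔼 X)²` tends to `0`. -/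
theorem of_moments [∀ n, Nonempty (Ω n)] (h₁ : Tendsto (fun n => 𝔼 ω, X n ω) atTop (𝓝 c))
    {b : ℕ → ℝ} (h₂ : ∀ᶠ n in atTop, 𝔼 ω, X n ω ^ 2 ≤ b n) (hb : Tendsto b atTop (𝓝 (c ^ 2))) :
    TendstoInMean X c := by
  have hlim : Tendsto (fun n => b n - 2 * c * 𝔼 ω, X n ω + c ^ 2) atTop (𝓝 0) := by
    convert (hb.sub (h₁.const_mul (2 * c))).add_const (c ^ 2) using 2
    ring
  refine of_expect_sq (squeeze_zero'
    (Eventually.of_forall fun n => Finset.expect_nonneg fun ω _ => sq_nonneg _) ?_ hlim)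
  filter_upwards [h₂] with n hn
  calc 𝔼 ω, (X n ω - c) ^ 2
      = 𝔼 ω, (X n ω ^ 2 - 2 * c * X n ω + c ^ 2) :=
        Finset.expect_congr rfl fun ω _ => by ring
    _ = 𝔼 ω, X n ω ^ 2 - 2 * c * 𝔼 ω, X n ω + c ^ 2 := by
        rw [Finset.expect_add_distrib, Finset.expect_sub_distrib, Fintype.expect_const,
          Finset.mul_expect]
    _ ≤ b n - 2 * c * 𝔼 ω, X n ω + c ^ 2 := by gcongr

theorem tendsto_toOuterMeasure_uniformOfFintype [∀ n, Nonempty (Ω n)] (h : TendstoInMean X c)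
    {ε : ℝ} (hε : 0 < ε) :
    Tendsto (fun n => (PMF.uniformOfFintype (Ω n)).toOuterMeasure {ω | |X n ω - c| < ε})
      atTop (𝓝 1) := by
  have hlim : Tendsto (fun n => ENNReal.ofReal (1 - (𝔼 ω, |X n ω - c|) / ε)) atTop (𝓝 1) := by
    simpa using ENNReal.tendsto_ofReal ((Tendsto.div_const h ε).const_sub 1)
  refine tendsto_of_tendsto_of_tendsto_of_le_of_le hlim tendsto_const_nhds (fun n => ?_)
    fun n => (PMF.toOuterMeasure_mono _ (subset_univ _)).trans_eq
      ((PMF.toOuterMeasure_apply_eq_one_iff _ _).2 (subset_univ _))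
  have hmarkov (ω : Ω n) :
      1 - |X n ω - c| / ε ≤ {ω | |X n ω - c| < ε}.indicator (1 : Ω n → ℝ) ω := by
    by_cases hω : |X n ω - c| < ε
    · rw [indicator_of_mem (by exact hω), Pi.one_apply, sub_le_self_iff]
      positivity
    · rw [indicator_of_notMem (by exact hω), sub_nonpos, one_le_div hε]
      exact not_lt.1 hω
  rw [toOuterMeasure_uniformOfFintype_eq_expect]
  refine ENNReal.ofReal_le_ofReal ?_
  rw [← Fintype.expect_const (ι := Ω n) (1 : ℝ), Finset.expect_div, ← Finset.expect_sub_distrib]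
  exact Finset.expect_le_expect fun ω _ => hmarkov ω

end TendstoInMean

end TendstoInMean

theorem tendsto_descFactorial_div_pow {L : ℕ → ℕ} {l : ℝ}
    (h : Tendsto (fun n => (L n : ℝ) / n) atTop (𝓝 l)) (k : ℕ) :
    Tendsto (fun n => ((L n).descFactorial k : ℝ) / (n : ℝ) ^ k) atTop (𝓝 (l ^ k)) := by
  have hlo : Tendsto (fun n => ((L n + 1 - k : ℕ) : ℝ) / n) atTop (𝓝 l) := by
    refine tendsto_of_tendsto_of_tendsto_of_le_of_le'
      (by simpa using h.sub (tendsto_const_div_atTop_nhds_zero_nat (k : ℝ)))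
      (by simpa using h.add (tendsto_const_div_atTop_nhds_zero_nat (1 : ℝ)))
      (Eventually.of_forall fun n => ?_) (Eventually.of_forall fun n => ?_)
    · rw [← sub_div]
      gcongr
      rw [sub_le_iff_le_add]
      exact_mod_cast (by omega : L n ≤ L n + 1 - k + k)
    · rw [inv_eq_one_div, ← add_div]
      gcongr
      exact_mod_cast Nat.sub_le _ _
  refine tendsto_of_tendsto_of_tendsto_of_le_of_le (hlo.pow k) (h.pow k) (fun n => ?_) fun n => ?_
  · simp only [div_pow]
    gcongr
    exact_mod_cast Nat.pow_sub_le_descFactorial (L n) k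
  · simp only [div_pow]
    gcongr
    exact_mod_cast Nat.descFactorial_le_pow (L n) k

theorem tendsto_choose_div_pow {L : ℕ → ℕ} {l : ℝ}
    (h : Tendsto (fun n => (L n : ℝ) / n) atTop (𝓝 l)) (k : ℕ) :
    Tendsto (fun n => ((L n).choose k : ℝ) / (n : ℝ) ^ k) atTop (𝓝 (l ^ k / k.factorial)) := by
  refine ((tendsto_descFactorial_div_pow h k).div_const (k.factorial : ℝ)).congr fun n => ?_
  rw [Nat.descFactorial_eq_factorial_mul_choose, Nat.cast_mul, div_right_comm,
    mul_div_cancel_left₀ _ (by positivity)]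

theorem tendsto_natCast_div_self : Tendsto (fun n : ℕ => (n : ℝ) / n) atTop (𝓝 1) :=
  tendsto_const_nhds.congr' <| (eventually_ne_atTop 0).mono fun _ hn =>
    (div_self (Nat.cast_ne_zero.2 hn)).symm

theorem expect_card_eq_sum {Ω ι : Type*} [Fintype Ω] [Fintype ι] [DecidableEq ι]
    (A : Ω → Finset ι) :
    𝔼 ω, (#(A ω) : ℝ) = ∑ i, 𝔼 ω, if i ∈ A ω then (1 : ℝ) else 0 := by
  simp [← Finset.expect_sum_comm]

theorem expect_card_sq_le {Ω ι : Type*} [Fintype Ω] [Nonempty Ω] [Fintype ι] [DecidableEq ι]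
    (A : Ω → Finset ι) {q : ℝ} (hq₀ : 0 ≤ q) {D : Finset (ι × ι)}
    (hq : ∀ p ∉ D, (𝔼 ω, if p.1 ∈ A ω ∧ p.2 ∈ A ω then (1 : ℝ) else 0) ≤ q) :
    𝔼 ω, (#(A ω) : ℝ) ^ 2 ≤ (Fintype.card ι : ℝ) ^ 2 * q + #D := by
  have hpair (p : ι × ι) : (𝔼 ω, if p.1 ∈ A ω ∧ p.2 ∈ A ω then (1 : ℝ) else 0) ≤
      q + if p ∈ D then 1 else 0 := by
    split_ifs with hp
    · refine le_add_of_nonneg_of_le hq₀ ((Finset.expect_le_expect fun ω _ => ?_).trans_eq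
        (Fintype.expect_const (ι := Ω) (1 : ℝ)))
      split_ifs <;> norm_num
    · rw [add_zero]
      exact hq p hp
  calc 𝔼 ω, (#(A ω) : ℝ) ^ 2
      = 𝔼 ω, (#(A ω ×ˢ A ω) : ℝ) :=
        Finset.expect_congr rfl fun ω _ => by rw [Finset.card_product, Nat.cast_mul, sq]
    _ = ∑ p : ι × ι, 𝔼 ω, if p.1 ∈ A ω ∧ p.2 ∈ A ω then (1 : ℝ) else 0 := by
        simp only [expect_card_eq_sum, Finset.mem_product]
    _ ≤ ∑ p : ι × ι, (q + if p ∈ D then 1 else 0) := Finset.sum_le_sum fun p _ => hpair p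
    _ = (Fintype.card ι : ℝ) ^ 2 * q + #D := by
        rw [Finset.sum_add_distrib, Finset.sum_const, Finset.card_univ, Fintype.card_prod]
        simp [sq]

theorem expect_smul {G X : Type*} [Group G] [Fintype G] [MulAction G X] [Fintype X]
    [MulAction.IsPretransitive G X] (x : X) (f : X → ℝ) : 𝔼 g : G, f (g • x) = 𝔼 y, f y := by
  have : Nonempty X := ⟨x⟩
  have horbit (y : X) : 𝔼 g : G, f (g • y) = 𝔼 g : G, f (g • x) := by
    obtain ⟨h, rfl⟩ := MulAction.exists_smul_eq G x y
    exact Fintype.expect_equiv (Equiv.mulRight h) _ _ fun g => by simp [mul_smul]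
  calc 𝔼 g : G, f (g • x)
      = 𝔼 y : X, 𝔼 g : G, f (g • y) := by simp only [horbit, Fintype.expect_const]
    _ = 𝔼 g : G, 𝔼 y : X, f (g • y) := Finset.expect_comm _ _ _
    _ = 𝔼 _g : G, 𝔼 y : X, f y := Finset.expect_congr rfl fun g _ =>
        Fintype.expect_equiv (MulAction.toPerm g) _ _ fun y => by simp
    _ = 𝔼 y, f y := Fintype.expect_const _

theorem expect_smul_mem {G X : Type*} [Group G] [Fintype G] [MulAction G X] [Fintype X]
    [DecidableEq X] [MulAction.IsPretransitive G X] (x : X) (S : Finset X) :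
    (𝔼 g : G, if g • x ∈ S then (1 : ℝ) else 0) = #S / Fintype.card X := by
  rw [expect_smul x fun y => if y ∈ S then (1 : ℝ) else 0]
  simp [Fintype.expect_eq_sum_div_card]

instance isPretransitive_perm_embedding {α β : Type*} [Finite α] :
    MulAction.IsPretransitive (Equiv.Perm β) (α ↪ β) where
  exists_smul_eq f g := by
    obtain ⟨σ, hσ⟩ := Equiv.Perm.exists_extending_pair f g f.injective g.injective
    exact ⟨σ, Function.Embedding.ext hσ⟩

theorem expect_smul_mem_and_smul_mem_le {α β : Type*} [Fintype α] [Fintype β] [DecidableEq β]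
    [DecidableEq (α ↪ β)] {e f : α ↪ β} (hef : Disjoint (range e) (range f)) (B : Finset (α ↪ β)) :
    (𝔼 π : Equiv.Perm β, if π • e ∈ B ∧ π • f ∈ B then (1 : ℝ) else 0) ≤
      (#B : ℝ) ^ 2 / (Fintype.card β).descFactorial (2 * Fintype.card α) := by
  let split := Equiv.sumEmbeddingEquivProdEmbeddingDisjoint (α := α) (β := α) (γ := β)
  let S : Finset (α ⊕ α ↪ β) := {w | (split w).1 ∈ B ×ˢ B}
  have hS : #S ≤ #B ^ 2 := by
    rw [sq, ← Finset.card_product]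
    refine Finset.card_le_card_of_injOn (fun w => (split w).1) (fun w hw => ?_)
      (Subtype.val_injective.comp split.injective).injOn
    exact (Finset.mem_filter.1 hw).2
  have hmem (π : Equiv.Perm β) :
      (π • e ∈ B ∧ π • f ∈ B) ↔ π • split.symm ⟨(e, f), hef⟩ ∈ S := by
    rw [Finset.mem_filter, Finset.mem_product]
    exact ⟨fun h => ⟨Finset.mem_univ _, h⟩, fun h => h.2⟩
  simp only [hmem]
  rw [expect_smul_mem, Fintype.card_embedding_eq, Fintype.card_sum, ← two_mul]
  gcongr
  exact_mod_cast hS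

theorem card_filter_val_mem (n : ℕ) (T : Finset ℕ) :
    #{i : Fin n | (i : ℕ) ∈ T} = #{m ∈ T | m < n} := by
  rw [← Finset.card_map Fin.valEmbedding]
  congr 1
  ext m
  simp only [Finset.mem_map, Finset.mem_filter, Finset.mem_univ, true_and, Fin.valEmbedding_apply]
  exact ⟨by rintro ⟨i, hi, rfl⟩; exact ⟨hi, i.2⟩, fun h => ⟨⟨m, h.2⟩, h.1, rfl⟩⟩

theorem card_filter_val_mem_Ico {n a b : ℕ} (hb : b ≤ n) :
    #{i : Fin n | (i : ℕ) ∈ Finset.Ico a b} = b - a := by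
  rw [card_filter_val_mem, Finset.filter_true_of_mem, Nat.card_Ico]
  exact fun m hm => (Finset.mem_Ico.1 hm).2.trans_le hb

/-- The `k + 1` consecutive positions ending at `p`. -/
def window {n k : ℕ} (p : Fin n) (h : k ≤ p) : Fin (k + 1) ↪ Fin n where
  toFun j := ⟨p - (k - j), by omega⟩
  inj' a b hab := by
    rw [Fin.mk.injEq] at hab
    omega

theorem val_window {n k : ℕ} (p : Fin n) (h : k ≤ p) (j : Fin (k + 1)) :
    (window p h j : ℕ) = p - (k - j) :=
  rfl

/-- The last positions of the windows in which `π` takes values forming a tuple in `B`. -/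
def windowEnds {n k : ℕ} (B : Finset (Fin (k + 1) ↪ Fin n)) (π : Equiv.Perm (Fin n)) :
    Finset (Fin n) :=
  {p | ∃ h : k ≤ p, π • window p h ∈ B}

section WindowEnds

variable {n k : ℕ} {B : Finset (Fin (k + 1) ↪ Fin n)}

theorem mem_windowEnds {π : Equiv.Perm (Fin n)} {p : Fin n} :
    p ∈ windowEnds B π ↔ ∃ h : k ≤ p, π • window p h ∈ B := by
  simp [windowEnds]

theorem expect_mem_windowEnds {p : Fin n} (hp : k ≤ p) :
    (𝔼 π, if p ∈ windowEnds B π then (1 : ℝ) else 0) = #B / n.descFactorial (k + 1) := by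
  simp only [mem_windowEnds, exists_prop_of_true hp]
  rw [expect_smul_mem, Fintype.card_embedding_eq, Fintype.card_fin, Fintype.card_fin]

theorem expect_card_windowEnds :
    𝔼 π, (#(windowEnds B π) : ℝ) = (n - k : ℕ) * (#B / n.descFactorial (k + 1)) := by
  have hterm (p : Fin n) : (𝔼 π, if p ∈ windowEnds B π then (1 : ℝ) else 0) =
      if k ≤ (p : ℕ) then (#B / n.descFactorial (k + 1) : ℝ) else 0 := by
    split_ifs with hp
    · exact expect_mem_windowEnds hp
    · simp [mem_windowEnds, hp]
  have hcard : #{p : Fin n | k ≤ (p : ℕ)} = n - k := by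
    simpa using card_filter_val_mem_Ico (a := k) (le_refl n)
  rw [expect_card_eq_sum, Finset.sum_congr rfl fun p _ => hterm p, ← Finset.sum_filter,
    Finset.sum_const, hcard, nsmul_eq_mul]

theorem disjoint_range_window {p q : Fin n} (hp : k ≤ p) (hq : k ≤ q)
    (hpq : (p : ℕ) + k < q ∨ (q : ℕ) + k < p) :
    Disjoint (range (window p hp)) (range (window q hq)) := by
  rw [disjoint_range_iff]
  intro a b hab
  have := congrArg Fin.val hab
  simp only [val_window] at this
  omega

theorem expect_mem_windowEnds_and_mem_windowEnds_le {p q : Fin n}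
    (hpq : (p : ℕ) + k < q ∨ (q : ℕ) + k < p) :
    (𝔼 π, if p ∈ windowEnds B π ∧ q ∈ windowEnds B π then (1 : ℝ) else 0) ≤
      (#B : ℝ) ^ 2 / n.descFactorial (2 * (k + 1)) := by
  by_cases h : k ≤ p ∧ k ≤ q
  · simp only [mem_windowEnds, exists_prop_of_true h.1, exists_prop_of_true h.2]
    simpa using expect_smul_mem_and_smul_mem_le (disjoint_range_window h.1 h.2 hpq) B
  · have hempty (π : Equiv.Perm (Fin n)) : ¬(p ∈ windowEnds B π ∧ q ∈ windowEnds B π) :=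
      fun hpq => h ⟨(mem_windowEnds.1 hpq.1).1, (mem_windowEnds.1 hpq.2).1⟩
    simp only [hempty, if_false, Finset.expect_const_zero]
    positivity

theorem card_overlapping_le (n k : ℕ) :
    #{p : Fin n × Fin n | (p.2 : ℕ) ≤ p.1 + k ∧ (p.1 : ℕ) ≤ p.2 + k} ≤ n * (2 * k + 1) := by
  have hfiber (p : Fin n) :
      #{q : Fin n | (q : ℕ) ≤ p + k ∧ (p : ℕ) ≤ q + k} ≤ 2 * k + 1 := by
    calc #{q : Fin n | (q : ℕ) ≤ p + k ∧ (p : ℕ) ≤ q + k}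
        = #{q : Fin n | (q : ℕ) ∈ Finset.Icc ((p : ℕ) - k) (p + k)} := by
          simp [and_comm]
      _ ≤ #(Finset.Icc ((p : ℕ) - k) (p + k)) := by
          rw [card_filter_val_mem]
          exact Finset.card_filter_le _ _
      _ ≤ 2 * k + 1 := by
          rw [Nat.card_Icc]
          omega
  calc #{p : Fin n × Fin n | (p.2 : ℕ) ≤ p.1 + k ∧ (p.1 : ℕ) ≤ p.2 + k}
      = ∑ p : Fin n, #{q : Fin n | (q : ℕ) ≤ p + k ∧ (p : ℕ) ≤ q + k} := by
        simp only [Finset.card_filter, Fintype.sum_prod_type]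
    _ ≤ ∑ _p : Fin n, (2 * k + 1) := Finset.sum_le_sum fun p _ => hfiber p
    _ = n * (2 * k + 1) := by simp

theorem expect_card_windowEnds_sq_le (B : Finset (Fin (k + 1) ↪ Fin n)) :
    𝔼 π, (#(windowEnds B π) : ℝ) ^ 2 ≤
      (n : ℝ) ^ 2 * ((#B : ℝ) ^ 2 / n.descFactorial (2 * (k + 1))) + n * (2 * k + 1) := by
  refine (expect_card_sq_le (windowEnds B) (by positivity) fun p hp =>
    expect_mem_windowEnds_and_mem_windowEnds_le (k := k) ?_).trans
      (add_le_add (by rw [Fintype.card_fin]) (by exact_mod_cast card_overlapping_le n k))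
  simp only [Finset.mem_filter, Finset.mem_univ, true_and] at hp
  omega

end WindowEnds

theorem tendstoInMean_card_windowEnds {k : ℕ} {c : ℝ} (B : ∀ n : ℕ, Finset (Fin (k + 1) ↪ Fin n))
    (hc : Tendsto (fun n => (#(B n) : ℝ) / (n : ℝ) ^ (k + 1)) atTop (𝓝 c)) :
    TendstoInMean (fun n π => (#(windowEnds (B n) π) : ℝ) / n) c := by
  have hsub : Tendsto (fun n : ℕ => ((n - k : ℕ) : ℝ) / n) atTop (𝓝 1) := by
    have h := tendsto_natCast_div_self.sub (tendsto_const_div_atTop_nhds_zero_nat (k : ℝ))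
    rw [sub_zero] at h
    refine h.congr' ((eventually_ge_atTop k).mono fun n hn => ?_)
    simp only [Nat.cast_sub hn, sub_div]
  have hdesc (m : ℕ) :
      Tendsto (fun n : ℕ => (n.descFactorial m : ℝ) / (n : ℝ) ^ m) atTop (𝓝 1) := by
    simpa using tendsto_descFactorial_div_pow tendsto_natCast_div_self m
  refine TendstoInMean.of_moments (b := fun n : ℕ => ((n : ℝ) ^ 2 *
      ((#(B n) : ℝ) ^ 2 / n.descFactorial (2 * (k + 1))) + n * (2 * k + 1)) / n ^ 2) ?_ ?_ ?_
  · have h := hsub.mul (hc.div (hdesc (k + 1)) one_ne_zero)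
    rw [div_one, one_mul] at h
    refine h.congr' ((eventually_ne_atTop 0).mono fun n hn => ?_)
    simp only [← Finset.expect_div, expect_card_windowEnds]
    rw [Pi.div_apply, div_div_div_cancel_right₀ (by positivity), mul_div_right_comm]
  · refine Eventually.of_forall fun n => ?_
    simp only [div_pow, ← Finset.expect_div]
    gcongr
    exact expect_card_windowEnds_sq_le (B n)
  · have h := ((hc.pow 2).div (hdesc (2 * (k + 1))) one_ne_zero).add
      (tendsto_const_div_atTop_nhds_zero_nat (2 * k + 1 : ℝ))
    rw [div_one, add_zero] at h
    refine h.congr' ((eventually_ne_atTop 0).mono fun n hn => ?_)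
    rw [Pi.div_apply, div_pow, ← pow_mul, mul_comm (k + 1) 2,
      div_div_div_cancel_right₀ (by positivity)]
    field_simp

/-- The increasing `k`-tuples with entries in `T`. -/
noncomputable def increasingTuples {α : Type*} [LinearOrder α] [Fintype α] (k : ℕ) (T : Finset α) :
    Finset (Fin k ↪ α) :=
  {w | StrictMono w ∧ ∀ j, w j ∈ T}

/-- The increasing `(k + 1)`-tuples whose first entry lies in `S` and whose other entries lie
in `T`. -/
noncomputable def crossingTuples {α : Type*} [LinearOrder α] [Fintype α] (k : ℕ) (S T : Finset α) :
    Finset (Fin (k + 1) ↪ α) :=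
  {w | StrictMono w ∧ w 0 ∈ S ∧ ∀ j : Fin k, w j.succ ∈ T}

section Tuples

variable {α : Type*} [LinearOrder α] [Fintype α] {k : ℕ} {S T : Finset α}

theorem mem_increasingTuples {w : Fin k ↪ α} :
    w ∈ increasingTuples k T ↔ StrictMono w ∧ ∀ j, w j ∈ T := by
  simp [increasingTuples]

theorem mem_crossingTuples {w : Fin (k + 1) ↪ α} :
    w ∈ crossingTuples k S T ↔ StrictMono w ∧ w 0 ∈ S ∧ ∀ j : Fin k, w j.succ ∈ T := by
  simp [crossingTuples]

theorem card_increasingTuples (k : ℕ) (T : Finset α) :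
    #(increasingTuples k T) = (#T).choose k := by
  rw [← Finset.card_powersetCard]
  refine Finset.card_bij (fun w _ => Finset.univ.map w) (fun w hw => ?_) (fun w hw v hv h => ?_)
    fun s hs => ?_
  · rw [mem_increasingTuples] at hw
    exact Finset.mem_powersetCard.2 ⟨by simpa [Finset.subset_iff] using hw.2, by simp⟩
  · rw [mem_increasingTuples] at hw hv
    refine DFunLike.coe_injective ((StrictMono.range_inj hw.1 hv.1).1 ?_)
    simpa using congrArg (fun s : Finset α => (s : Set α)) h
  · obtain ⟨hsT, hsk⟩ := Finset.mem_powersetCard.1 hs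
    refine ⟨(s.orderEmbOfFin hsk).toEmbedding, mem_increasingTuples.2
      ⟨(s.orderEmbOfFin hsk).strictMono, fun j => hsT (s.orderEmbOfFin_mem hsk j)⟩, ?_⟩
    rw [← Finset.coe_inj]
    simp

theorem card_crossingTuples (k : ℕ) (hST : ∀ a ∈ S, ∀ b ∈ T, a < b) :
    #(crossingTuples k S T) = #S * (#T).choose k := by
  rw [← card_increasingTuples k T, ← Finset.card_product]
  refine Finset.card_bij (fun w _ => (w 0, Fin.Embedding.tail w)) (fun w hw => ?_)
    (fun w _ v _ h => ?_) fun p hp => ?_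
  · obtain ⟨hw, hS, hT⟩ := mem_crossingTuples.1 hw
    exact Finset.mem_product.2 ⟨hS, mem_increasingTuples.2 ⟨hw.comp Fin.strictMono_succ, hT⟩⟩
  · obtain ⟨h₀, hsucc⟩ := Prod.mk.inj h
    ext j
    exact Fin.cases h₀ (fun j => DFunLike.congr_fun hsucc j) j
  · obtain ⟨a, v⟩ := p
    obtain ⟨ha, hv⟩ := Finset.mem_product.1 hp
    obtain ⟨hmono, hvT⟩ := mem_increasingTuples.1 hv
    have hav : a ∉ range v := by
      rintro ⟨j, rfl⟩
      exact lt_irrefl _ (hST _ ha _ (hvT j))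
    have hcons : StrictMono (Fin.Embedding.cons v hav) := by
      rcases k with _ | k
      · exact Subsingleton.strictMono (α := Fin 1) _
      · exact strictMono_vecCons.2 ⟨hST a ha _ (hvT 0), hmono⟩
    exact ⟨Fin.Embedding.cons v hav, mem_crossingTuples.2 ⟨hcons, ha, hvT⟩, rfl⟩

end Tuples

section WindowTuples

variable {n k : ℕ} {π : Equiv.Perm (Fin n)} {p : Fin n}

theorem window_strictMono (h : k ≤ p) : StrictMono (window p h) := by
  intro a b hab
  simp only [Fin.lt_def, val_window] at hab ⊢
  omega

theorem range_window (h : k ≤ p) : range (window p h) = Icc (window p h 0) p := by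
  ext x
  simp only [mem_range, mem_Icc, Fin.le_def, Fin.ext_iff, val_window, Fin.val_zero]
  exact ⟨by rintro ⟨j, hj⟩; omega, fun hx => ⟨⟨x + k - p, by omega⟩, by simp only; omega⟩⟩

theorem range_window_succ (h : k ≤ p) :
    range (fun j : Fin k => window p h j.succ) = Ioc (window p h 0) p := by
  ext x
  simp only [mem_range, mem_Ioc, Fin.le_def, Fin.lt_def, Fin.ext_iff, val_window, Fin.val_zero,
    Fin.val_succ]
  exact ⟨by rintro ⟨j, hj⟩; omega, fun hx => ⟨⟨x + k - p - 1, by omega⟩, by simp only; omega⟩⟩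

theorem strictMono_smul_window_iff (h : k ≤ p) :
    StrictMono (π • window p h) ↔ StrictMonoOn π (Icc (window p h 0) p) := by
  rw [← range_window h]
  constructor
  · rintro hw _ ⟨a, rfl⟩ _ ⟨b, rfl⟩ hab
    exact hw ((window_strictMono h).lt_iff_lt.1 hab)
  · exact fun hπ a b hab => hπ (mem_range_self a) (mem_range_self b) (window_strictMono h hab)

theorem exists_window_zero_iff {P : Fin n → Prop} :
    (∃ h : k ≤ p, P (window p h 0)) ↔ ∃ q : Fin n, (q : ℕ) + k = p ∧ P q := by
  constructor
  · rintro ⟨h, hP⟩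
    exact ⟨window p h 0, by simp [val_window, h], hP⟩
  · rintro ⟨q, hq, hP⟩
    have h : k ≤ p := by omega
    have hqw : window p h 0 = q := by
      ext
      simp [val_window, ← hq]
    exact ⟨h, hqw ▸ hP⟩

theorem mem_windowEnds_increasingTuples {T : Finset (Fin n)} :
    p ∈ windowEnds (increasingTuples (k + 1) T) π ↔
      ∃ q : Fin n, (q : ℕ) + k = p ∧ StrictMonoOn π (Icc q p) ∧ ∀ x ∈ Icc q p, π x ∈ T := by
  rw [← exists_window_zero_iff, mem_windowEnds]
  refine exists_congr fun h => ?_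
  rw [mem_increasingTuples, strictMono_smul_window_iff, ← range_window, forall_mem_range]
  rfl

theorem mem_windowEnds_crossingTuples {S T : Finset (Fin n)} :
    p ∈ windowEnds (crossingTuples k S T) π ↔ ∃ q : Fin n, (q : ℕ) + k = p ∧
      StrictMonoOn π (Icc q p) ∧ π q ∈ S ∧ ∀ x ∈ Ioc q p, π x ∈ T := by
  rw [← exists_window_zero_iff, mem_windowEnds]
  refine exists_congr fun h => ?_
  rw [mem_crossingTuples, strictMono_smul_window_iff, ← range_window_succ, forall_mem_range]
  rfl

end WindowTuples

section Runs

variable {n : ℕ} {π : Equiv.Perm (Fin n)} {M Y : ℕ}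

theorem mem_run_iff {i j : Fin n} : j ∈ run π i ↔ StrictMonoOn π (uIcc i j) := by
  simp only [run, Finset.mem_filter, Finset.mem_univ, true_and, StrictMonoOn, uIcc, mem_Icc]
  exact ⟨fun h a ha b hb hab => h a b ha.1 hab hb.2,
    fun h a b ha hab hb => h ⟨ha, hab.le.trans hb⟩ ⟨ha.trans hab.le, hb⟩ hab⟩

theorem runMin_le (π : Equiv.Perm (Fin n)) (p : Fin n) : runMin π p ≤ π p :=
  Finset.inf'_le _ (mem_run_self π p)

theorem runMin_lt_iff {p : Fin n} :
    (runMin π p : ℕ) < M ↔ ∃ q ≤ p, StrictMonoOn π (Icc q p) ∧ (π q : ℕ) < M := by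
  constructor
  · intro h
    obtain ⟨j, hj, hjr⟩ := Finset.exists_mem_eq_inf' ⟨p, mem_run_self π p⟩ π
    rw [runMin, hjr] at h
    rw [mem_run_iff] at hj
    rcases le_total j p with hjp | hpj
    · rw [uIcc_of_ge hjp] at hj
      exact ⟨j, hjp, hj, h⟩
    · rw [uIcc_of_le hpj] at hj
      refine ⟨p, le_rfl, by simp, lt_of_le_of_lt ?_ h⟩
      exact hj.monotoneOn (left_mem_Icc.2 hpj) (right_mem_Icc.2 hpj) hpj
  · rintro ⟨q, hqp, hπ, hq⟩
    refine lt_of_le_of_lt (Fin.le_def.1 (Finset.inf'_le _ ?_)) hq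
    rwa [mem_run_iff, uIcc_of_ge hqp]

/-- The positions of the entries of `π` that are less than `Y` and lie in a run whose smallest entry
is less than `M`. -/
def lowRunPositions (M Y : ℕ) (π : Equiv.Perm (Fin n)) : Finset (Fin n) :=
  {p | (runMin π p : ℕ) < M ∧ (π p : ℕ) < Y}

theorem mem_lowRunPositions {p : Fin n} :
    p ∈ lowRunPositions M Y π ↔ (runMin π p : ℕ) < M ∧ (π p : ℕ) < Y := by
  simp [lowRunPositions]

theorem card_lowRunPositions_of_le (h : Y ≤ M) (hY : Y ≤ n) (π : Equiv.Perm (Fin n)) :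
    #(lowRunPositions M Y π) = Y := by
  refine (Finset.card_equiv π fun p => ?_).trans (card_filter_val_mem_Ico (a := 0) hY)
  have := Fin.le_def.1 (runMin_le π p)
  simp only [mem_lowRunPositions, Finset.mem_filter, Finset.mem_univ, true_and, Finset.mem_Ico]
  omega

/-- The end positions of the windows of length `k + 1` in which `π` increases, from an entry less
than `M` to entries in `[M, Y)`. For given `M` and `Y`, a position is such an end for at most one
`k`. -/
noncomputable def crossingEnds (M Y k : ℕ) (π : Equiv.Perm (Fin n)) : Finset (Fin n) :=
  windowEnds (crossingTuples k {v | (v : ℕ) ∈ Finset.Ico 0 M} {v | (v : ℕ) ∈ Finset.Ico M Y}) π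

/-- The end positions of the windows of length `k + 1` in which `π` increases and has its values
in `[M, Y)`. -/
noncomputable def increasingEnds (M Y k : ℕ) (π : Equiv.Perm (Fin n)) : Finset (Fin n) :=
  windowEnds (increasingTuples (k + 1) {v | (v : ℕ) ∈ Finset.Ico M Y}) π

theorem mem_crossingEnds {k : ℕ} {p : Fin n} :
    p ∈ crossingEnds M Y k π ↔ ∃ q : Fin n, (q : ℕ) + k = p ∧ StrictMonoOn π (Icc q p) ∧
      (π q : ℕ) < M ∧ ∀ x ∈ Ioc q p, M ≤ (π x : ℕ) ∧ (π x : ℕ) < Y := by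
  simp [crossingEnds, mem_windowEnds_crossingTuples]

theorem mem_increasingEnds {k : ℕ} {p : Fin n} :
    p ∈ increasingEnds M Y k π ↔ ∃ q : Fin n, (q : ℕ) + k = p ∧ StrictMonoOn π (Icc q p) ∧
      ∀ x ∈ Icc q p, M ≤ (π x : ℕ) ∧ (π x : ℕ) < Y := by
  simp [increasingEnds, mem_windowEnds_increasingTuples]

theorem crossingEnds_subset_lowRunPositions (hMY : M ≤ Y) (k : ℕ) (π : Equiv.Perm (Fin n)) :
    crossingEnds M Y k π ⊆ lowRunPositions M Y π := by
  intro p hp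
  obtain ⟨q, hqk, hπ, hq, hT⟩ := mem_crossingEnds.1 hp
  have hqp : q ≤ p := Fin.le_def.2 (by omega)
  refine mem_lowRunPositions.2 ⟨runMin_lt_iff.2 ⟨q, hqp, hπ, hq⟩, ?_⟩
  rcases hqp.eq_or_lt with rfl | hqp
  · exact hq.trans_le hMY
  · exact (hT p (right_mem_Ioc.2 hqp)).2

theorem disjoint_crossingEnds {k l : ℕ} (hkl : k ≠ l) (π : Equiv.Perm (Fin n)) :
    Disjoint (crossingEnds M Y k π) (crossingEnds M Y l π) := by
  wlog h : l < k generalizing k l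
  · exact (this hkl.symm (lt_of_le_of_ne (not_lt.1 h) hkl)).symm
  refine Finset.disjoint_left.2 fun p hk hl => ?_
  obtain ⟨q, hqk, -, -, hT⟩ := mem_crossingEnds.1 hk
  obtain ⟨r, hrl, -, hr, -⟩ := mem_crossingEnds.1 hl
  exact (hT r ⟨Fin.lt_def.2 (by omega), Fin.le_def.2 (by omega)⟩).1.not_gt hr

theorem sum_card_crossingEnds_le (hMY : M ≤ Y) (K : ℕ) (π : Equiv.Perm (Fin n)) :
    ∑ k ∈ Finset.range K, #(crossingEnds M Y k π) ≤ #(lowRunPositions M Y π) := by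
  rw [← Finset.card_biUnion fun k _ l _ hkl => disjoint_crossingEnds hkl π]
  exact Finset.card_le_card
    (Finset.biUnion_subset.2 fun k _ => crossingEnds_subset_lowRunPositions hMY k π)

/-- Going left from a position of `lowRunPositions M Y π`, the first entry less than `M` is met
before the run is left. -/
theorem exists_last_lt_of_mem_lowRunPositions {p : Fin n} (hp : p ∈ lowRunPositions M Y π) :
    ∃ q ≤ p, StrictMonoOn π (Icc q p) ∧ (π q : ℕ) < M ∧
      ∀ x ∈ Ioc q p, M ≤ (π x : ℕ) ∧ (π x : ℕ) < Y := by
  obtain ⟨hpM, hpY⟩ := mem_lowRunPositions.1 hp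
  obtain ⟨r, hrp, hπ, hr⟩ := runMin_lt_iff.1 hpM
  obtain ⟨q, hq, hmax⟩ := Finset.exists_max_image
    {x ∈ Finset.Icc r p | (π x : ℕ) < M} id ⟨r, by simp [hrp, hr]⟩
  obtain ⟨hqI, hqM⟩ := Finset.mem_filter.1 hq
  obtain ⟨hrq, hqp⟩ := Finset.mem_Icc.1 hqI
  refine ⟨q, hqp, hπ.mono (Icc_subset_Icc_left hrq), hqM, fun x hx => ⟨?_, ?_⟩⟩
  · by_contra! hxM
    exact (hmax x (Finset.mem_filter.2
      ⟨Finset.mem_Icc.2 ⟨hrq.trans hx.1.le, hx.2⟩, hxM⟩)).not_gt hx.1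
  · exact (Fin.le_def.1 (hπ.monotoneOn ⟨hrq.trans hx.1.le, hx.2⟩ (right_mem_Icc.2 hrp)
      hx.2)).trans_lt hpY

theorem card_lowRunPositions_le (K : ℕ) (π : Equiv.Perm (Fin n)) :
    #(lowRunPositions M Y π) ≤
      ∑ k ∈ Finset.range (K + 1), #(crossingEnds M Y k π) + #(increasingEnds M Y K π) := by
  have hcover : lowRunPositions M Y π ⊆
      (Finset.range (K + 1)).biUnion (fun k => crossingEnds M Y k π) ∪ increasingEnds M Y K π := by
    intro p hp
    obtain ⟨q, hqp, hπ, hq, hT⟩ := exists_last_lt_of_mem_lowRunPositions hp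
    rw [Finset.mem_union, Finset.mem_biUnion]
    replace hqp := Fin.le_def.1 hqp
    rcases Nat.lt_or_ge (p - q) (K + 1) with hK | hK
    · exact Or.inl ⟨p - q, Finset.mem_range.2 hK,
        mem_crossingEnds.2 ⟨q, by omega, hπ, hq, hT⟩⟩
    · have hqr : q < (⟨p - K, by omega⟩ : Fin n) := Fin.lt_def.2 (by simp only; omega)
      exact Or.inr (mem_increasingEnds.2 ⟨⟨p - K, by omega⟩, by simp only; omega,
        hπ.mono (Icc_subset_Icc_left hqr.le), fun x hx => hT x ⟨hqr.trans_le hx.1, hx.2⟩⟩)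
  exact (Finset.card_le_card hcover).trans ((Finset.card_union_le _ _).trans
    (Nat.add_le_add_right Finset.card_biUnion_le _))

/-- `runsort π` puts the entries of the runs with smallest entry less than `M` in an initial
segment of positions. -/
theorem lt_card_lowRunPositions_iff (i : Fin n) :
    (i : ℕ) < #(lowRunPositions M n π) ↔ (runMin π (Tuple.sort (runMin π) i) : ℕ) < M := by
  have hmono : Monotone fun j => (runMin π (Tuple.sort (runMin π) j) : ℕ) + 1 := fun a b hab =>
    Nat.succ_le_succ (Fin.le_def.1 (Tuple.monotone_sort (runMin π) hab))
  have hcard : #(lowRunPositions M n π) =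
      #{j | (runMin π (Tuple.sort (runMin π) j) : ℕ) + 1 ≤ M} :=
    (Finset.card_equiv (Tuple.sort (runMin π)) fun j => by
      simp [mem_lowRunPositions]).symm
  rw [hcard]
  exact Tuple.lt_card_le_iff_apply_le_of_monotone hmono

theorem card_lt_lowRunPositions_and_runsort_lt (M Y : ℕ) (π : Equiv.Perm (Fin n)) :
    #{i : Fin n | (i : ℕ) < #(lowRunPositions M n π) ∧ (runsort π i : ℕ) < Y} =
      #(lowRunPositions M Y π) := by
  refine Finset.card_equiv (Tuple.sort (runMin π)) fun i => ?_
  simp [lt_card_lowRunPositions_iff, mem_lowRunPositions, runsort]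

end Runs

section NatCeil

variable {a b : ℝ}

theorem tendsto_natCeil_mul_div (ha : 0 ≤ a) :
    Tendsto (fun n : ℕ => (⌈a * n⌉₊ : ℝ) / n) atTop (𝓝 a) :=
  (tendsto_nat_ceil_mul_div_atTop ha).comp tendsto_natCast_atTop_atTop

theorem natCeil_mul_le (ha : a ≤ 1) (n : ℕ) : ⌈a * n⌉₊ ≤ n :=
  Nat.ceil_le.2 (mul_le_of_le_one_left (Nat.cast_nonneg n) ha)

theorem natCeil_mul_mono (h : a ≤ b) (n : ℕ) : ⌈a * n⌉₊ ≤ ⌈b * n⌉₊ :=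
  Nat.ceil_mono (mul_le_mul_of_nonneg_right h (Nat.cast_nonneg n))

theorem tendsto_natCeil_sub_div (ha : 0 ≤ a) (hab : a ≤ b) :
    Tendsto (fun n : ℕ => ((⌈b * n⌉₊ - ⌈a * n⌉₊ : ℕ) : ℝ) / n) atTop (𝓝 (b - a)) := by
  refine ((tendsto_natCeil_mul_div (ha.trans hab)).sub (tendsto_natCeil_mul_div ha)).congr
    fun n => ?_
  rw [Nat.cast_sub (natCeil_mul_mono hab n), sub_div]

end NatCeil

/-- The limiting proportion of the entries that are less than `y` and lie in a run with smallest
entry less than `s`, with entries scaled to the unit interval. -/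
noncomputable def lowRunDensity (s y : ℝ) : ℝ := min s y * Real.exp (y - min s y)

section LowRunLimit

variable {s y : ℝ}

theorem tendstoInMean_card_crossingEnds (hs : 0 ≤ s) (hsy : s ≤ y) (hy : y ≤ 1) (k : ℕ) :
    TendstoInMean
      (fun n (π : Equiv.Perm (Fin n)) => (#(crossingEnds ⌈s * n⌉₊ ⌈y * n⌉₊ k π) : ℝ) / n)
      (s * ((y - s) ^ k / k.factorial)) := by
  refine tendstoInMean_card_windowEnds _ (((tendsto_natCeil_mul_div hs).mul
    (tendsto_choose_div_pow (tendsto_natCeil_sub_div hs hsy) k)).congr fun n => ?_)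
  rw [card_crossingTuples, card_filter_val_mem_Ico (natCeil_mul_le (hsy.trans hy) n),
    card_filter_val_mem_Ico (natCeil_mul_le hy n), Nat.sub_zero, Nat.cast_mul, pow_succ',
    mul_div_mul_comm]
  intro a ha b hb
  simp only [Finset.mem_filter, Finset.mem_univ, true_and, Finset.mem_Ico] at ha hb
  exact Fin.lt_def.2 (ha.2.trans_le hb.1)

theorem tendstoInMean_card_increasingEnds (hs : 0 ≤ s) (hsy : s ≤ y) (hy : y ≤ 1) (k : ℕ) :
    TendstoInMean
      (fun n (π : Equiv.Perm (Fin n)) => (#(increasingEnds ⌈s * n⌉₊ ⌈y * n⌉₊ k π) : ℝ) / n)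
      ((y - s) ^ (k + 1) / (k + 1).factorial) := by
  refine tendstoInMean_card_windowEnds _
    ((tendsto_choose_div_pow (tendsto_natCeil_sub_div hs hsy) (k + 1)).congr fun n => ?_)
  rw [card_increasingTuples, card_filter_val_mem_Ico (natCeil_mul_le hy n)]

theorem tendstoInMean_card_lowRunPositions_of_le (hs : 0 ≤ s) (hsy : s ≤ y) (hy : y ≤ 1) :
    TendstoInMean
      (fun n (π : Equiv.Perm (Fin n)) => (#(lowRunPositions ⌈s * n⌉₊ ⌈y * n⌉₊ π) : ℝ) / n)
      (s * Real.exp (y - s)) := by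
  have hcross (K : ℕ) := TendstoInMean.sum (Finset.range K)
    fun k _ => tendstoInMean_card_crossingEnds hs hsy hy k
  have hseries : HasSum (fun k : ℕ => s * ((y - s) ^ k / k.factorial)) (s * Real.exp (y - s)) := by
    rw [Real.exp_eq_exp_ℝ]
    exact (NormedSpace.expSeries_div_hasSum_exp (y - s)).mul_left s
  have htail : Tendsto (fun K => (y - s) ^ (K + 1) / (K + 1).factorial) atTop (𝓝 0) :=
    (FloorSemiring.tendsto_pow_div_factorial_atTop (y - s)).comp (tendsto_add_atTop_nat 1)
  refine TendstoInMean.of_sandwich hcross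
    (fun K => (hcross (K + 1)).add (tendstoInMean_card_increasingEnds hs hsy hy K))
    hseries.tendsto_sum_nat ?_ (fun K => .of_forall fun n π => ?_)
    fun K => .of_forall fun n π => ?_
  · simpa using (hseries.tendsto_sum_nat.comp (tendsto_add_atTop_nat 1)).add htail
  · rw [← Finset.sum_div]
    gcongr
    exact_mod_cast sum_card_crossingEnds_le (natCeil_mul_mono hsy n) K π
  · rw [← Finset.sum_div, ← add_div]
    gcongr
    exact_mod_cast card_lowRunPositions_le K π

theorem tendstoInMean_card_lowRunPositions (hs : 0 ≤ s) (hy₀ : 0 ≤ y) (hy₁ : y ≤ 1) :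
    TendstoInMean
      (fun n (π : Equiv.Perm (Fin n)) => (#(lowRunPositions ⌈s * n⌉₊ ⌈y * n⌉₊ π) : ℝ) / n)
      (lowRunDensity s y) := by
  rcases le_total y s with hys | hsy
  · simp only [card_lowRunPositions_of_le (natCeil_mul_mono hys _) (natCeil_mul_le hy₁ _),
      lowRunDensity, min_eq_right hys, sub_self, Real.exp_zero, mul_one]
    exact TendstoInMean.of_tendsto (tendsto_natCeil_mul_div hy₀)
  · simpa only [lowRunDensity, min_eq_left hsy] using
      tendstoInMean_card_lowRunPositions_of_le hs hsy hy₁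

end LowRunLimit

/-- The measure `γ` on the plane has both marginals uniform on the unit interval. Unlike in
`IsPermuton`, the marginals are image measures, so that `γ` is not cut off to the unit square. -/
structure HasUniformMarginals (γ : Measure (ℝ × ℝ)) : Prop where
  fst : MeasurePreserving Prod.fst γ (volume.restrict (Icc 0 1))
  snd : MeasurePreserving Prod.snd γ (volume.restrict (Icc 0 1))

/-- The joint distribution function of a measure on the plane. -/
noncomputable def jointCDF (γ : Measure (ℝ × ℝ)) (x y : ℝ) : ℝ :=
  γ.real (Iic x ×ˢ Iic y)

theorem measureReal_Ioc_prod_Ioc {γ : Measure (ℝ × ℝ)} [IsFiniteMeasure γ] {x₁ x₂ y₁ y₂ : ℝ}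
    (hx : x₁ ≤ x₂) (hy : y₁ ≤ y₂) :
    γ.real (Ioc x₁ x₂ ×ˢ Ioc y₁ y₂) =
      jointCDF γ x₂ y₂ - jointCDF γ x₁ y₂ - jointCDF γ x₂ y₁ + jointCDF γ x₁ y₁ := by
  have hsplit_fst (y : ℝ) :
      jointCDF γ x₂ y = jointCDF γ x₁ y + γ.real (Ioc x₁ x₂ ×ˢ Iic y) := by
    rw [jointCDF, ← Iic_union_Ioc_eq_Iic hx, union_prod, jointCDF, measureReal_union]
    · exact disjoint_prod.2 (Or.inl (Iic_disjoint_Ioc le_rfl))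
    · exact measurableSet_Ioc.prod measurableSet_Iic
  have hsplit_snd : γ.real (Ioc x₁ x₂ ×ˢ Iic y₂) =
      γ.real (Ioc x₁ x₂ ×ˢ Iic y₁) + γ.real (Ioc x₁ x₂ ×ˢ Ioc y₁ y₂) := by
    rw [← Iic_union_Ioc_eq_Iic hy, prod_union, measureReal_union]
    · exact disjoint_prod.2 (Or.inr (Iic_disjoint_Ioc le_rfl))
    · exact measurableSet_Ioc.prod measurableSet_Ioc
  linarith [hsplit_fst y₁, hsplit_fst y₂]

namespace HasUniformMarginals

variable {γ γ₁ γ₂ : Measure (ℝ × ℝ)}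

theorem isProbabilityMeasure (h : HasUniformMarginals γ) : IsProbabilityMeasure γ :=
  ⟨(h.fst.measure_preimage MeasurableSet.univ.nullMeasurableSet).trans (by simp)⟩

theorem measure_Icc_prod_Icc_zero_one (h : HasUniformMarginals γ) {a b : ℝ} (ha : 0 ≤ a)
    (hb : b ≤ 1) : γ (Icc a b ×ˢ Icc (0 : ℝ) 1) = ENNReal.ofReal (b - a) := by
  have hsnd : Prod.snd ⁻¹' Icc (0 : ℝ) 1 =ᵐ[γ] univ :=
    h.snd.quasiMeasurePreserving.preimage_ae_eq (ae_eq_univ.2 (by simp))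
  rw [Set.prod_eq, measure_congr ((ae_eq_refl _).inter hsnd), inter_univ,
    h.fst.measure_preimage measurableSet_Icc.nullMeasurableSet,
    Measure.restrict_apply measurableSet_Icc, inter_eq_left.2 (Icc_subset_Icc ha hb),
    Real.volume_Icc]

theorem measure_Icc_zero_one_prod_Icc (h : HasUniformMarginals γ) {a b : ℝ} (ha : 0 ≤ a)
    (hb : b ≤ 1) : γ (Icc (0 : ℝ) 1 ×ˢ Icc a b) = ENNReal.ofReal (b - a) := by
  have hfst : Prod.fst ⁻¹' Icc (0 : ℝ) 1 =ᵐ[γ] univ :=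
    h.fst.quasiMeasurePreserving.preimage_ae_eq (ae_eq_univ.2 (by simp))
  rw [Set.prod_eq, measure_congr (hfst.inter (ae_eq_refl (Prod.snd ⁻¹' Icc a b))), univ_inter,
    h.snd.measure_preimage measurableSet_Icc.nullMeasurableSet,
    Measure.restrict_apply measurableSet_Icc, inter_eq_left.2 (Icc_subset_Icc ha hb),
    Real.volume_Icc]

theorem isPermuton (h : HasUniformMarginals γ) : IsPermuton γ where
  isProbabilityMeasure := h.isProbabilityMeasure
  outside := by
    have := h.isProbabilityMeasure
    rw [prob_compl_eq_zero_iff (measurableSet_Icc.prod measurableSet_Icc),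
      h.measure_Icc_prod_Icc_zero_one le_rfl le_rfl]
    simp
  marginal_fst _ _ ha _ hb := h.measure_Icc_prod_Icc_zero_one ha hb
  marginal_snd _ _ ha _ hb := h.measure_Icc_zero_one_prod_Icc ha hb

theorem abs_jointCDF_sub_le (h : HasUniformMarginals γ) (x x' y y' : ℝ) :
    |jointCDF γ x y - jointCDF γ x' y'| ≤ |x' - x| + |y' - y| := by
  have := h.isProbabilityMeasure
  have hstrip {f : ℝ × ℝ → ℝ} (hf : MeasurePreserving f γ (volume.restrict (Icc 0 1)))
      (a b : ℝ) : γ.real (f ⁻¹' uIoc a b) ≤ |b - a| := by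
    refine ENNReal.toReal_le_of_le_ofReal (abs_nonneg _) ?_
    rw [hf.measure_preimage measurableSet_uIoc.nullMeasurableSet, ← Real.volume_uIoc]
    exact Measure.restrict_apply_le _ _
  have hsubset : symmDiff (Iic x ×ˢ Iic y) (Iic x' ×ˢ Iic y') ⊆
      Prod.fst ⁻¹' uIoc x x' ∪ Prod.snd ⁻¹' uIoc y y' := by
    rintro ⟨u, v⟩
    simp only [mem_symmDiff, mem_prod, mem_Iic, mem_union, mem_preimage, mem_uIoc]
    grind
  calc |jointCDF γ x y - jointCDF γ x' y'|
      ≤ γ.real (symmDiff (Iic x ×ˢ Iic y) (Iic x' ×ˢ Iic y')) :=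
        abs_measureReal_sub_le_measureReal_symmDiff
          (measurableSet_Iic.prod measurableSet_Iic).nullMeasurableSet
          (measurableSet_Iic.prod measurableSet_Iic).nullMeasurableSet
    _ ≤ γ.real (Prod.fst ⁻¹' uIoc x x') + γ.real (Prod.snd ⁻¹' uIoc y y') :=
        (measureReal_mono hsubset).trans (measureReal_union_le _ _)
    _ ≤ |x' - x| + |y' - y| := add_le_add (hstrip h.fst x x') (hstrip h.snd y y')

theorem measureReal_Icc_prod_Icc (h : HasUniformMarginals γ) {x₁ x₂ y₁ y₂ : ℝ} (hx : x₁ ≤ x₂)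
    (hy : y₁ ≤ y₂) :
    γ.real (Icc x₁ x₂ ×ˢ Icc y₁ y₂) =
      jointCDF γ x₂ y₂ - jointCDF γ x₁ y₂ - jointCDF γ x₂ y₁ + jointCDF γ x₁ y₁ := by
  have := h.isProbabilityMeasure
  rw [← measureReal_Ioc_prod_Ioc hx hy]
  exact measureReal_congr ((h.fst.quasiMeasurePreserving.preimage_ae_eq Ioc_ae_eq_Icc.symm).inter
    (h.snd.quasiMeasurePreserving.preimage_ae_eq Ioc_ae_eq_Icc.symm))

theorem rectDist_le (h₁ : HasUniformMarginals γ₁) (h₂ : HasUniformMarginals γ₂) {δ : ℝ}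
    (hδ : ∀ x ∈ Icc (0 : ℝ) 1, ∀ y ∈ Icc (0 : ℝ) 1, |jointCDF γ₁ x y - jointCDF γ₂ x y| ≤ δ) :
    rectDist γ₁ γ₂ ≤ 4 * δ := by
  have hδ₀ : 0 ≤ δ := (abs_nonneg _).trans (hδ 0 (by simp) 0 (by simp))
  refine Real.sSup_le ?_ (by positivity)
  rintro r ⟨x₁, x₂, y₁, y₂, hx₁, hx, hx₂, hy₁, hy, hy₂, rfl⟩
  rw [h₁.measureReal_Icc_prod_Icc hx hy, h₂.measureReal_Icc_prod_Icc hx hy]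
  have h22 := abs_le.1 (hδ x₂ ⟨hx₁.trans hx, hx₂⟩ y₂ ⟨hy₁.trans hy, hy₂⟩)
  have h12 := abs_le.1 (hδ x₁ ⟨hx₁, hx.trans hx₂⟩ y₂ ⟨hy₁.trans hy, hy₂⟩)
  have h21 := abs_le.1 (hδ x₂ ⟨hx₁.trans hx, hx₂⟩ y₁ ⟨hy₁, hy.trans hy₂⟩)
  have h11 := abs_le.1 (hδ x₁ ⟨hx₁, hx.trans hx₂⟩ y₁ ⟨hy₁, hy.trans hy₂⟩)
  rw [abs_le]
  constructor <;> linarith [h22.1, h22.2, h12.1, h12.2, h21.1, h21.2, h11.1, h11.2]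

end HasUniformMarginals

theorem rectDist_nonneg (γ₁ γ₂ : Measure (ℝ × ℝ)) : 0 ≤ rectDist γ₁ γ₂ :=
  Real.sSup_nonneg <| by
    rintro r ⟨x₁, x₂, y₁, y₂, -, -, -, -, -, -, rfl⟩
    exact abs_nonneg _

theorem exists_natCast_div_near {x : ℝ} (hx : x ∈ Icc (0 : ℝ) 1) {N : ℕ} (hN : 0 < N) :
    ∃ j ∈ Finset.range (N + 1), |j / N - x| ≤ 1 / N := by
  have hN' : (0 : ℝ) < N := Nat.cast_pos.2 hN
  have hxN : 0 ≤ x * N := mul_nonneg hx.1 hN'.le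
  refine ⟨⌊x * N⌋₊, Finset.mem_range_succ_iff.2
    (Nat.floor_le_of_le (mul_le_of_le_one_left hN'.le hx.2)), ?_⟩
  rw [abs_sub_comm, abs_of_nonneg (sub_nonneg.2 ((div_le_iff₀ hN').2 (Nat.floor_le hxN))),
    sub_le_iff_le_add, ← add_div, le_div_iff₀ hN', add_comm]
  exact (Nat.lt_floor_add_one _).le

theorem HasUniformMarginals.rectDist_le_sum {γ₁ γ₂ : Measure (ℝ × ℝ)} (h₁ : HasUniformMarginals γ₁)
    (h₂ : HasUniformMarginals γ₂) {N : ℕ} (hN : 0 < N) :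
    rectDist γ₁ γ₂ ≤ 4 * (4 * (1 / N) + ∑ p ∈ Finset.range (N + 1) ×ˢ Finset.range (N + 1),
      |jointCDF γ₁ (p.1 / N) (p.2 / N) - jointCDF γ₂ (p.1 / N) (p.2 / N)|) := by
  refine h₁.rectDist_le h₂ fun x hx y hy => ?_
  obtain ⟨j, hj, hjx⟩ := exists_natCast_div_near hx hN
  obtain ⟨l, hl, hly⟩ := exists_natCast_div_near hy hN
  have hgrid := Finset.single_le_sum (f := fun p : ℕ × ℕ =>
    |jointCDF γ₁ (p.1 / N) (p.2 / N) - jointCDF γ₂ (p.1 / N) (p.2 / N)|)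
    (fun p _ => abs_nonneg _) (Finset.mk_mem_product hj hl)
  have hγ₁ := abs_le.1 (h₁.abs_jointCDF_sub_le x (j / N) y (l / N))
  have hγ₂ := abs_le.1 (h₂.abs_jointCDF_sub_le x (j / N) y (l / N))
  have hgrid := abs_le.1 hgrid
  rw [abs_le]
  constructor <;> linarith [hγ₁.1, hγ₁.2, hγ₂.1, hγ₂.2, hgrid.1, hgrid.2]

theorem tendstoInMean_rectDist {Ω : ℕ → Type*} [∀ n, Fintype (Ω n)] [∀ n, Nonempty (Ω n)]
    {Γ : ∀ n, Ω n → Measure (ℝ × ℝ)} {γ : Measure (ℝ × ℝ)}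
    (hΓ : ∀ᶠ n in atTop, ∀ ω, HasUniformMarginals (Γ n ω)) (hγ : HasUniformMarginals γ)
    (h : ∀ x ∈ Icc (0 : ℝ) 1, ∀ y ∈ Icc (0 : ℝ) 1,
      TendstoInMean (fun n ω => jointCDF (Γ n ω) x y) (jointCDF γ x y)) :
    TendstoInMean (fun n ω => rectDist (Γ n ω) γ) 0 := by
  have hunit {N j : ℕ} (hj : j ∈ Finset.range (N + 1 + 1)) :
      (j / (N + 1 : ℕ) : ℝ) ∈ Icc (0 : ℝ) 1 :=
    ⟨by positivity, div_le_one_of_le₀ (mod_cast Finset.mem_range_succ_iff.1 hj) (by positivity)⟩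
  have hgrid (N : ℕ) := TendstoInMean.sum
    (Finset.range (N + 1 + 1) ×ˢ Finset.range (N + 1 + 1)) fun p hp =>
      (h _ (hunit (Finset.mem_product.1 hp).1) _ (hunit (Finset.mem_product.1 hp).2)).abs_sub
  have hupper (N : ℕ) := ((TendstoInMean.of_tendsto
    (tendsto_const_nhds (x := 4 * (1 / ((N + 1 : ℕ) : ℝ))))).add (hgrid N)).const_mul 4
  refine TendstoInMean.of_sandwich
    (fun _ => TendstoInMean.of_tendsto (tendsto_const_nhds (x := 0))) hupper
    tendsto_const_nhds ?_ (fun _ => .of_forall fun _ _ => rectDist_nonneg _ _) fun N => ?_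
  · have := (tendsto_one_div_add_atTop_nhds_zero_nat (𝕜 := ℝ)).const_mul (4 * 4)
    simpa [mul_assoc] using this
  · filter_upwards [hΓ] with n hn ω
    exact (hn ω).rectDist_le_sum hγ N.succ_pos

/-- The `j`-th of the intervals of length `1 / n` into which the half-line `[0, ∞)` is divided,
counted from `0`. -/
def gridInterval (n j : ℕ) : Set ℝ := Ico ((j : ℝ) / n) (((j : ℝ) + 1) / n)

section PermMeasure

variable {n : ℕ}

theorem mem_gridInterval (hn : 0 < n) {j : ℕ} {x : ℝ} :
    x ∈ gridInterval n j ↔ 0 ≤ x ∧ ⌊x * n⌋₊ = j := by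
  have hn' : (0 : ℝ) < n := Nat.cast_pos.2 hn
  rw [gridInterval, mem_Ico, div_le_iff₀ hn', lt_div_iff₀ hn']
  constructor
  · intro h
    have hxn : 0 ≤ x * n := j.cast_nonneg.trans h.1
    exact ⟨nonneg_of_mul_nonneg_left hxn hn', (Nat.floor_eq_iff hxn).2 h⟩
  · rintro ⟨hx, hj⟩
    exact (Nat.floor_eq_iff (by positivity)).1 hj

theorem disjoint_gridInterval (hn : 0 < n) {i j : ℕ} (hij : i ≠ j) :
    Disjoint (gridInterval n i) (gridInterval n j) :=
  disjoint_left.2 fun _ hi hj =>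
    hij (((mem_gridInterval hn).1 hi).2.symm.trans ((mem_gridInterval hn).1 hj).2)

theorem iUnion_gridInterval (hn : 0 < n) : ⋃ i : Fin n, gridInterval n i = Ico (0 : ℝ) 1 := by
  ext x
  have hfloor (hx : 0 ≤ x) : ⌊x * n⌋₊ < n ↔ x < 1 := by
    rw [Nat.floor_lt (by positivity), mul_lt_iff_lt_one_left (by positivity)]
  simp only [mem_iUnion, mem_gridInterval hn, mem_Ico]
  exact ⟨fun ⟨i, hx, hi⟩ => ⟨hx, (hfloor hx).1 (hi ▸ i.2)⟩,
    fun ⟨hx, hx₁⟩ => ⟨⟨_, (hfloor hx).2 hx₁⟩, hx, rfl⟩⟩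

theorem volume_gridInterval (hn : 0 < n) (j : ℕ) : volume (gridInterval n j) = (n : ENNReal)⁻¹ := by
  rw [gridInterval, Real.volume_Ico, ← sub_div, add_sub_cancel_left, one_div,
    ENNReal.ofReal_inv_of_pos (Nat.cast_pos.2 hn), ENNReal.ofReal_natCast]

theorem volume_Iic_inter_gridInterval (hn : 0 < n) (a j : ℕ) :
    volume (Iic ((a : ℝ) / n) ∩ gridInterval n j) = if j < a then (n : ENNReal)⁻¹ else 0 := by
  split_ifs with h
  · rw [inter_eq_self_of_subset_right, volume_gridInterval hn]
    have hja : (j : ℝ) + 1 ≤ a := mod_cast h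
    exact fun x hx => hx.2.le.trans (by gcongr)
  · have haj : (a : ℝ) ≤ j := mod_cast not_lt.1 h
    refine measure_mono_null (t := {(a : ℝ) / n}) (fun x hx => ?_) Real.volume_singleton
    exact le_antisymm hx.1 (le_trans (by gcongr) hx.2.1)

theorem sum_restrict_gridInterval (hn : 0 < n) :
    ∑ i : Fin n, volume.restrict (gridInterval n i) = volume.restrict (Icc (0 : ℝ) 1) := by
  rw [← restrict_Ico_eq_restrict_Icc, ← iUnion_gridInterval hn, Measure.restrict_iUnion,
    Measure.sum_fintype]
  · exact fun i j hij => disjoint_gridInterval hn (Fin.val_injective.ne hij)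
  · exact fun i => measurableSet_Ico

theorem permMeasure_eq_sum (hn : 0 < n) (σ : Equiv.Perm (Fin n)) :
    permMeasure σ = (n : ENNReal) • ∑ i : Fin n, (volume.restrict (gridInterval n i)).prod
      (volume.restrict (gridInterval n (σ i))) := by
  rw [permMeasure, withDensity_const, Measure.restrict_iUnion, Measure.sum_fintype]
  · simp only [Measure.prod_restrict]
    rfl
  · exact fun i j hij => disjoint_prod.2
      (Or.inl (disjoint_gridInterval hn (Fin.val_injective.ne hij)))
  · exact fun i => measurableSet_Ico.prod measurableSet_Ico

theorem hasUniformMarginals_permMeasure (hn : 0 < n) (σ : Equiv.Perm (Fin n)) :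
    HasUniformMarginals (permMeasure σ) := by
  have hcancel : (n : ENNReal) * (n : ENNReal)⁻¹ = 1 :=
    ENNReal.mul_inv_cancel (by exact_mod_cast hn.ne') (ENNReal.natCast_ne_top n)
  refine ⟨⟨measurable_fst, ?_⟩, ⟨measurable_snd, ?_⟩⟩ <;>
    rw [permMeasure_eq_sum hn, Measure.map_smul]
  · rw [Measure.map_finset_sum measurable_fst.aemeasurable]
    simp only [Measure.map_fst_prod, Measure.restrict_apply_univ, volume_gridInterval hn]
    rw [← Finset.smul_sum, smul_smul, hcancel, one_smul, sum_restrict_gridInterval hn]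
  · rw [Measure.map_finset_sum measurable_snd.aemeasurable]
    simp only [Measure.map_snd_prod, Measure.restrict_apply_univ, volume_gridInterval hn]
    rw [← Finset.smul_sum, smul_smul, hcancel, one_smul,
      Equiv.sum_comp σ fun i : Fin n => volume.restrict (gridInterval n i),
      sum_restrict_gridInterval hn]

theorem jointCDF_permMeasure_div (hn : 0 < n) (σ : Equiv.Perm (Fin n)) (a b : ℕ) :
    jointCDF (permMeasure σ) (a / n) (b / n) =
      #{i : Fin n | (i : ℕ) < a ∧ (σ i : ℕ) < b} / (n : ℝ) := by
  have hterm (i : Fin n) : volume (Iic ((a : ℝ) / n) ∩ gridInterval n i) *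
      volume (Iic ((b : ℝ) / n) ∩ gridInterval n (σ i)) =
      (if (i : ℕ) < a ∧ (σ i : ℕ) < b then 1 else 0) * ((n : ENNReal)⁻¹ * (n : ENNReal)⁻¹) := by
    rw [volume_Iic_inter_gridInterval hn, volume_Iic_inter_gridInterval hn]
    split_ifs <;> simp_all
  have hmeasure : permMeasure σ (Iic ((a : ℝ) / n) ×ˢ Iic ((b : ℝ) / n)) =
      n * (#{i : Fin n | (i : ℕ) < a ∧ (σ i : ℕ) < b} * ((n : ENNReal)⁻¹ * (n : ENNReal)⁻¹)) := by
    rw [permMeasure_eq_sum hn, Measure.smul_apply, Measure.finsetSum_apply, smul_eq_mul,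
      ← Finset.sum_boole, Finset.sum_mul]
    simp only [Measure.prod_prod, Measure.restrict_apply measurableSet_Iic, hterm]
  rw [jointCDF, measureReal_def, hmeasure]
  simp only [ENNReal.toReal_mul, ENNReal.toReal_natCast, ENNReal.toReal_inv]
  field_simp

end PermMeasure

/-- The map `y ↦ y e ^ (1 - y)`, whose graph over the `y`-axis carries the singular part of the
runsort permuton. -/
noncomputable def curve (s : ℝ) : ℝ := s * Real.exp (1 - s)

theorem curve_zero : curve 0 = 0 := by simp [curve]

theorem curve_one : curve 1 = 1 := by simp [curve]

theorem continuous_curve : Continuous curve := by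
  unfold curve
  fun_prop

theorem hasDerivAt_curve (s : ℝ) : HasDerivAt curve ((1 - s) * Real.exp (1 - s)) s := by
  have h : HasDerivAt (fun s : ℝ => s * Real.exp (1 - s))
      (1 * Real.exp (1 - s) + s * (Real.exp (1 - s) * -1)) s :=
    (hasDerivAt_id' s).mul ((hasDerivAt_id' s).const_sub 1).exp
  exact h.congr_deriv (by ring)

theorem curve_strictMonoOn : StrictMonoOn curve (Icc 0 1) := by
  refine strictMonoOn_of_deriv_pos (convex_Icc 0 1) continuous_curve.continuousOn fun s hs => ?_
  rw [interior_Icc] at hs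
  rw [(hasDerivAt_curve s).deriv]
  exact mul_pos (sub_pos.2 hs.2) (Real.exp_pos _)

theorem curve_mem_Icc {s : ℝ} (hs : s ∈ Icc (0 : ℝ) 1) : curve s ∈ Icc (0 : ℝ) 1 := by
  have hmono := curve_strictMonoOn.monotoneOn
  exact ⟨curve_zero ▸ hmono (left_mem_Icc.2 zero_le_one) hs hs.1,
    curve_one ▸ hmono hs (right_mem_Icc.2 zero_le_one) hs.2⟩

theorem exists_curve_eq {x : ℝ} (hx : x ∈ Icc (0 : ℝ) 1) : ∃ s ∈ Icc (0 : ℝ) 1, curve s = x := by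
  have h := intermediate_value_Icc zero_le_one (continuous_curve.continuousOn (s := Icc 0 1))
  rw [curve_zero, curve_one] at h
  exact h hx

theorem exp_sub_one_mul_curve (s u : ℝ) : Real.exp (u - 1) * curve s = s * Real.exp (u - s) := by
  rw [curve, show u - s = u - 1 + (1 - s) by ring, Real.exp_add]
  ring

theorem lowRunDensity_one {s : ℝ} (hs : s ≤ 1) : lowRunDensity s 1 = curve s := by
  rw [lowRunDensity, min_eq_left hs, curve]

theorem mem_aboveCurve {p : ℝ × ℝ} :
    p ∈ aboveCurve ↔ p.1 ∈ Ico 0 (curve p.2) ∧ p.2 ∈ Icc (0 : ℝ) 1 :=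
  ⟨fun ⟨⟨h₁, h₂⟩, h⟩ => ⟨⟨h₁.1, h⟩, h₂⟩,
    fun ⟨h₁, h₂⟩ => ⟨⟨⟨h₁.1, h₁.2.le.trans (curve_mem_Icc h₂).2⟩, h₂⟩, h₁.2⟩⟩

theorem measurableSet_aboveCurve : MeasurableSet aboveCurve :=
  (measurableSet_Icc.prod measurableSet_Icc).inter
    (measurableSet_lt measurable_fst (by fun_prop))

/-- The conditional law of the first coordinate under the runsort permuton, given that the second
coordinate is `y`. -/
noncomputable def rowMeasure (y : ℝ) : Measure ℝ :=
  ENNReal.ofReal (Real.exp (y - 1)) • volume.restrict (Ico 0 (curve y)) +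
    ENNReal.ofReal (1 - y) • Measure.dirac (curve y)

theorem rowMeasure_apply {A : Set ℝ} (hA : MeasurableSet A) (y : ℝ) :
    rowMeasure y A = ENNReal.ofReal (Real.exp (y - 1)) * volume (A ∩ Ico 0 (curve y)) +
      (curve ⁻¹' A).indicator (fun y => ENNReal.ofReal (1 - y)) y := by
  rw [rowMeasure, Measure.add_apply, Measure.smul_apply, Measure.smul_apply,
    Measure.restrict_apply hA, Measure.dirac_apply' _ hA, smul_eq_mul, smul_eq_mul]
  by_cases hy : curve y ∈ A <;> simp [indicator, hy]

theorem rowMeasure_eq_one {A : Set ℝ} (hA : MeasurableSet A) {y : ℝ} (hy : y ∈ Icc (0 : ℝ) 1)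
    (hyA : Icc 0 (curve y) ⊆ A) : rowMeasure y A = 1 := by
  have hc := (curve_mem_Icc hy).1
  rw [rowMeasure_apply hA, indicator_of_mem (show y ∈ curve ⁻¹' A from hyA (right_mem_Icc.2 hc)),
    inter_eq_self_of_subset_right (Ico_subset_Icc_self.trans hyA), Real.volume_Ico, sub_zero,
    ← ENNReal.ofReal_mul (Real.exp_nonneg _), exp_sub_one_mul_curve, sub_self, Real.exp_zero,
    mul_one, ← ENNReal.ofReal_add hy.1 (sub_nonneg.2 hy.2), add_sub_cancel, ENNReal.ofReal_one]

theorem rowMeasure_Iic_of_lt {s y : ℝ} (hs : s ∈ Icc (0 : ℝ) 1) (hy : y ∈ Icc (0 : ℝ) 1)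
    (hsy : s < y) : rowMeasure y (Iic (curve s)) = ENNReal.ofReal (s * Real.exp (y - s)) := by
  have hlt : curve s < curve y := curve_strictMonoOn hs hy hsy
  have hinter : Iic (curve s) ∩ Ico 0 (curve y) = Icc 0 (curve s) := by
    ext x
    exact ⟨fun h => ⟨h.2.1, h.1⟩, fun h => ⟨h.2, h.1, h.2.trans_lt hlt⟩⟩
  have hy_notMem : y ∉ curve ⁻¹' Iic (curve s) := hlt.not_ge
  rw [rowMeasure_apply measurableSet_Iic, indicator_of_notMem hy_notMem, hinter,
    Real.volume_Icc, add_zero, sub_zero, ← ENNReal.ofReal_mul (Real.exp_nonneg _),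
    exp_sub_one_mul_curve]

theorem withDensity_aboveCurve_prod {A B : Set ℝ} (hA : MeasurableSet A) (hB : MeasurableSet B) :
    ((volume.restrict aboveCurve).withDensity fun p => ENNReal.ofReal (Real.exp (p.2 - 1)))
      (A ×ˢ B) =
    ∫⁻ y in B ∩ Icc 0 1, ENNReal.ofReal (Real.exp (y - 1)) * volume (A ∩ Ico 0 (curve y)) := by
  have hE : MeasurableSet (A ×ˢ B ∩ aboveCurve) := (hA.prod hB).inter measurableSet_aboveCurve
  have hmem (x y : ℝ) :
      (x, y) ∈ A ×ˢ B ∩ aboveCurve ↔ y ∈ B ∩ Icc 0 1 ∧ x ∈ A ∩ Ico 0 (curve y) := by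
    simp only [mem_inter_iff, mem_prod, mem_aboveCurve]
    tauto
  rw [withDensity_apply _ (hA.prod hB), Measure.restrict_restrict (hA.prod hB),
    ← lintegral_indicator hE, Measure.volume_eq_prod,
    lintegral_prod_symm' _ (Measurable.indicator (by fun_prop) hE),
    ← lintegral_indicator (hB.inter measurableSet_Icc)]
  refine lintegral_congr fun y => ?_
  by_cases hy : y ∈ B ∩ Icc 0 1
  · rw [indicator_of_mem hy, ← setLIntegral_const,
      ← lintegral_indicator (hA.inter measurableSet_Ico)]
    refine lintegral_congr fun x => ?_
    classical
    simp only [indicator_apply, (hmem x y).trans (and_iff_right hy)]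
  · simp only [indicator, hmem, hy, false_and, if_false, lintegral_zero]

theorem runsortPermuton_prod {A B : Set ℝ} (hA : MeasurableSet A) (hB : MeasurableSet B) :
    runsortPermuton (A ×ˢ B) = ∫⁻ y in B ∩ Icc 0 1, rowMeasure y A := by
  have hcA : MeasurableSet (curve ⁻¹' A) := continuous_curve.measurable hA
  have hpre : (fun y : ℝ => (y * Real.exp (1 - y), y)) ⁻¹' (A ×ˢ B) = curve ⁻¹' A ∩ B := rfl
  simp only [rowMeasure_apply hA]
  rw [lintegral_add_right _ (Measurable.indicator (by fun_prop) hcA),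
    ← withDensity_aboveCurve_prod hA hB, setLIntegral_indicator hcA, ← inter_assoc,
    runsortPermuton, Measure.add_apply, Measure.map_apply (by fun_prop) (hA.prod hB), hpre,
    withDensity_apply _ (hcA.inter hB), Measure.restrict_restrict (hcA.inter hB)]

theorem runsortPermuton_prod_eq_volume {A B : Set ℝ} (hA : MeasurableSet A) (hB : MeasurableSet B)
    (hIA : Icc 0 1 ⊆ A) : runsortPermuton (A ×ˢ B) = volume (B ∩ Icc 0 1) := by
  rw [runsortPermuton_prod hA hB, ← setLIntegral_one]
  exact setLIntegral_congr_fun (hB.inter measurableSet_Icc) fun y hy =>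
    rowMeasure_eq_one hA hy.2 ((Icc_subset_Icc_right (curve_mem_Icc hy.2).2).trans hIA)

theorem lintegral_Ioc_const_mul_exp_sub {a b : ℝ} (ha : 0 ≤ a) (hab : a ≤ b) :
    ∫⁻ u in Ioc a b, ENNReal.ofReal (a * Real.exp (u - a)) =
      ENNReal.ofReal (a * Real.exp (b - a) - a) := by
  have hcont : Continuous fun u : ℝ => a * Real.exp (u - a) := by fun_prop
  rw [← ofReal_integral_eq_lintegral_ofReal
      (hcont.continuousOn.integrableOn_Icc.mono_set Ioc_subset_Icc_self)
      (ae_of_all _ fun u => mul_nonneg ha (Real.exp_nonneg _)),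
    ← intervalIntegral.integral_of_le hab, intervalIntegral.integral_const_mul,
    intervalIntegral.integral_comp_sub_right (fun u => Real.exp u), integral_exp, sub_self,
    Real.exp_zero, mul_sub, mul_one]

theorem runsortPermuton_Iic_prod_Iic {s y : ℝ} (hs : s ∈ Icc (0 : ℝ) 1)
    (hy : y ∈ Icc (0 : ℝ) 1) :
    runsortPermuton (Iic (curve s) ×ˢ Iic y) = ENNReal.ofReal (lowRunDensity s y) := by
  set m := min s y
  have hm₀ : 0 ≤ m := le_min hs.1 hy.1
  have hmy : m ≤ y := min_le_right s y
  have hbelow : ∫⁻ u in Icc 0 m, rowMeasure u (Iic (curve s)) = ENNReal.ofReal m := by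
    rw [setLIntegral_congr_fun (g := 1) measurableSet_Icc fun u hu => ?_]
    · simp
    have hus : u ≤ s := hu.2.trans (min_le_left s y)
    have hu₁ : u ∈ Icc (0 : ℝ) 1 := ⟨hu.1, hus.trans hs.2⟩
    exact rowMeasure_eq_one measurableSet_Iic hu₁ fun x hx =>
      hx.2.trans (curve_strictMonoOn.monotoneOn hu₁ hs hus)
  have habove : ∫⁻ u in Ioc m y, rowMeasure u (Iic (curve s)) =
      ENNReal.ofReal (m * Real.exp (y - m) - m) := by
    rw [← lintegral_Ioc_const_mul_exp_sub hm₀ hmy]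
    refine setLIntegral_congr_fun measurableSet_Ioc fun u hu => ?_
    have hsu : s < u := (min_lt_iff.1 hu.1).resolve_right hu.2.not_gt
    have hms : m = s := min_eq_left (hsu.le.trans hu.2)
    rw [hms]
    exact rowMeasure_Iic_of_lt hs ⟨hs.1.trans hsu.le, hu.2.trans hy.2⟩ hsu
  have hexp : m ≤ m * Real.exp (y - m) :=
    le_mul_of_one_le_right hm₀ (Real.one_le_exp (sub_nonneg.2 hmy))
  have hIcc : Iic y ∩ Icc 0 1 = Icc 0 m ∪ Ioc m y := by
    rw [Icc_union_Ioc_eq_Icc hm₀ hmy, ← Ici_inter_Iic, inter_left_comm, Iic_inter_Iic,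
      inf_eq_left.2 hy.2, Ici_inter_Iic]
  rw [runsortPermuton_prod measurableSet_Iic measurableSet_Iic, hIcc,
    lintegral_union measurableSet_Ioc
      (disjoint_left.2 fun u hu hu' => hu'.1.not_ge hu.2), hbelow, habove,
    ← ENNReal.ofReal_add hm₀ (sub_nonneg.2 hexp), add_sub_cancel, lowRunDensity]

theorem jointCDF_runsortPermuton {s y : ℝ} (hs : s ∈ Icc (0 : ℝ) 1) (hy : y ∈ Icc (0 : ℝ) 1) :
    jointCDF runsortPermuton (curve s) y = lowRunDensity s y := by
  rw [jointCDF, measureReal_def, runsortPermuton_Iic_prod_Iic hs hy, ENNReal.toReal_ofReal]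
  exact mul_nonneg (le_min hs.1 hy.1) (Real.exp_nonneg _)

theorem runsortPermuton_Iic_prod_univ (x : ℝ) :
    runsortPermuton (Iic x ×ˢ univ) = volume (Iic x ∩ Icc 0 1) := by
  have hinside {x : ℝ} (hx : x ∈ Icc (0 : ℝ) 1) :
      runsortPermuton (Iic x ×ˢ univ) = ENNReal.ofReal x := by
    obtain ⟨s, hs, rfl⟩ := exists_curve_eq hx
    have h := runsortPermuton_Iic_prod_Iic hs (right_mem_Icc.2 zero_le_one)
    rw [lowRunDensity_one hs.2, runsortPermuton_prod measurableSet_Iic measurableSet_Iic,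
      inter_eq_self_of_subset_right Icc_subset_Iic_self] at h
    rw [runsortPermuton_prod measurableSet_Iic .univ, univ_inter, h]
  rw [← Ici_inter_Iic, inter_left_comm, Iic_inter_Iic, Ici_inter_Iic, Real.volume_Icc, sub_zero]
  rcases lt_or_ge x 0 with hx₀ | hx₀
  · rw [ENNReal.ofReal_of_nonpos (min_le_of_left_le hx₀.le)]
    refine measure_mono_null (prod_mono_left (Iic_subset_Iic.2 hx₀.le)) ?_
    rw [hinside (left_mem_Icc.2 zero_le_one), ENNReal.ofReal_zero]
  rcases le_or_gt x 1 with hx₁ | hx₁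
  · rw [hinside ⟨hx₀, hx₁⟩, min_eq_left hx₁]
  · rw [runsortPermuton_prod_eq_volume measurableSet_Iic .univ
      (Icc_subset_Iic_self.trans (Iic_subset_Iic.2 hx₁.le)), univ_inter, Real.volume_Icc,
      sub_zero, min_eq_right hx₁.le]

theorem hasUniformMarginals_runsortPermuton : HasUniformMarginals runsortPermuton := by
  have hsnd : runsortPermuton.map Prod.snd = volume.restrict (Icc (0 : ℝ) 1) := by
    ext B hB
    rw [Measure.map_apply measurable_snd hB, Measure.restrict_apply hB, ← univ_prod,
      runsortPermuton_prod_eq_volume .univ hB (subset_univ _)]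
  have hfinite : IsFiniteMeasure runsortPermuton := by
    have : IsFiniteMeasure (runsortPermuton.map Prod.snd) := hsnd ▸ inferInstance
    exact Measure.isFiniteMeasure_of_map measurable_snd.aemeasurable
  have hfst : runsortPermuton.map Prod.fst = volume.restrict (Icc (0 : ℝ) 1) :=
    Measure.ext_of_Iic _ _ fun x => by
      rw [Measure.map_apply measurable_fst measurableSet_Iic,
        Measure.restrict_apply measurableSet_Iic, ← prod_univ, runsortPermuton_Iic_prod_univ]
  exact ⟨⟨measurable_fst, hfst⟩, ⟨measurable_snd, hsnd⟩⟩

/-- The closure of `aboveCurve`: the part of the unit square on or above the curve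
`x = y e ^ (1 - y)`. -/
def closedAboveCurve : Set (ℝ × ℝ) :=
  {p | p ∈ Icc (0 : ℝ) 1 ×ˢ Icc (0 : ℝ) 1 ∧ p.1 ≤ p.2 * Real.exp (1 - p.2)}

/-- The interior of `aboveCurve`. -/
def openAboveCurve : Set (ℝ × ℝ) :=
  {p | p.1 ∈ Ioo 0 (curve p.2) ∧ p.2 ∈ Ioo (0 : ℝ) 1}

theorem aboveCurve_subset_closedAboveCurve : aboveCurve ⊆ closedAboveCurve :=
  fun _ hp => ⟨hp.1, hp.2.le⟩

theorem openAboveCurve_subset_aboveCurve : openAboveCurve ⊆ aboveCurve := fun _ hp =>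
  mem_aboveCurve.2 ⟨Ioo_subset_Ico_self hp.1, Ioo_subset_Icc_self hp.2⟩

theorem isClosed_closedAboveCurve : IsClosed closedAboveCurve :=
  (isClosed_Icc.prod isClosed_Icc).inter (isClosed_le continuous_fst (by fun_prop))

theorem isOpen_openAboveCurve : IsOpen openAboveCurve :=
  ((isOpen_lt continuous_const continuous_fst).inter
    (isOpen_lt continuous_fst (continuous_curve.comp continuous_snd))).inter
    (isOpen_Ioo.preimage continuous_snd)

theorem closedAboveCurve_subset_closure_openAboveCurve :
    closedAboveCurve ⊆ closure openAboveCurve := by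
  rintro ⟨x, y⟩ ⟨⟨hx, hy⟩, hxy⟩
  have hc := (curve_mem_Icc hy).1
  -- The map below stretches the unit square horizontally onto the region above the curve.
  let f : ℝ × ℝ → ℝ × ℝ := fun q => (q.1 * curve q.2, q.2)
  have hf : Continuous f := by
    have := continuous_curve
    fun_prop
  have hmaps : f '' (Ioo 0 1 ×ˢ Ioo 0 1) ⊆ openAboveCurve := by
    rintro _ ⟨⟨r, z⟩, ⟨hr, hz⟩, rfl⟩
    have hcz : 0 < curve z := mul_pos hz.1 (Real.exp_pos _)
    exact ⟨⟨mul_pos hr.1 hcz, mul_lt_of_lt_one_left hcz hr.2⟩, hz⟩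
  have hmem : (x / curve y, y) ∈ closure (Ioo (0 : ℝ) 1 ×ˢ Ioo (0 : ℝ) 1) := by
    rw [closure_prod_eq, closure_Ioo zero_ne_one]
    exact ⟨⟨div_nonneg hx.1 hc, div_le_one_of_le₀ hxy hc⟩, hy⟩
  have hfxy : f (x / curve y, y) = (x, y) :=
    Prod.ext (div_mul_cancel_of_imp fun h => le_antisymm (h ▸ hxy) hx.1) rfl
  rw [← hfxy]
  exact closure_mono hmaps (image_closure_subset_closure_image hf (mem_image_of_mem f hmem))

theorem runsortPermuton_compl_closedAboveCurve : runsortPermuton closedAboveCurveᶜ = 0 := by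
  have hD : MeasurableSet closedAboveCurveᶜ := isClosed_closedAboveCurve.measurableSet.compl
  rw [runsortPermuton, Measure.add_apply, add_eq_zero, Measure.map_apply (by fun_prop) hD]
  refine ⟨withDensity_absolutelyContinuous _ _ ?_, withDensity_absolutelyContinuous _ _ ?_⟩
  · rw [Measure.restrict_apply hD, ← sdiff_eq_compl_inter,
      sdiff_eq_empty.2 aboveCurve_subset_closedAboveCurve, measure_empty]
  · rw [Measure.restrict_apply' measurableSet_Icc]
    refine measure_mono_null (t := ∅) ?_ measure_empty
    exact fun y hy => hy.1 ⟨⟨curve_mem_Icc hy.2, hy.2⟩, le_rfl⟩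

theorem runsortPermuton_pos_of_isOpen {U : Set (ℝ × ℝ)} (hU : IsOpen U)
    (hne : (U ∩ openAboveCurve).Nonempty) : 0 < runsortPermuton U := by
  have hvol : 0 < volume (U ∩ openAboveCurve) :=
    (hU.inter isOpen_openAboveCurve).measure_pos volume hne
  rw [runsortPermuton, Measure.add_apply]
  refine lt_of_lt_of_le ?_ le_self_add
  rw [withDensity_apply _ hU.measurableSet, Measure.restrict_restrict hU.measurableSet]
  refine (setLIntegral_pos_iff (by fun_prop)).2 (hvol.trans_le (measure_mono fun p hp => ?_))
  exact ⟨(ENNReal.ofReal_pos.2 (Real.exp_pos _)).ne', hp.1,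
    openAboveCurve_subset_aboveCurve hp.2⟩

theorem support_runsortPermuton : runsortPermuton.support = closedAboveCurve := by
  apply Subset.antisymm
  · refine Measure.support_subset_of_isClosed isClosed_closedAboveCurve ?_
    rw [mem_ae_iff, runsortPermuton_compl_closedAboveCurve]
  · intro p hp
    rw [Measure.support_eq_forall_isOpen]
    exact fun U hpU hU => runsortPermuton_pos_of_isOpen hU
      (mem_closure_iff.1 (closedAboveCurve_subset_closure_openAboveCurve hp) U hU hpU)

theorem tendstoInMean_card_lowRunPositions_div {s : ℝ} (hs : s ∈ Icc (0 : ℝ) 1) :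
    TendstoInMean (fun n (π : Equiv.Perm (Fin n)) =>
      (#(lowRunPositions ⌈s * n⌉₊ n π) : ℝ) / n) (curve s) := by
  simpa only [one_mul, Nat.ceil_natCast, lowRunDensity_one hs.2] using
    tendstoInMean_card_lowRunPositions hs.1 zero_le_one le_rfl

theorem tendstoInMean_jointCDF_runsort {s y : ℝ} (hs : s ∈ Icc (0 : ℝ) 1)
    (hy : y ∈ Icc (0 : ℝ) 1) :
    TendstoInMean (fun n (π : Equiv.Perm (Fin n)) =>
      jointCDF (permMeasure (runsort π)) (curve s) y) (jointCDF runsortPermuton (curve s) y) := by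
  rw [jointCDF_runsortPermuton hs hy]
  have hlow := tendstoInMean_card_lowRunPositions_div hs
  have hbox := tendstoInMean_card_lowRunPositions hs.1 hy.1 hy.2
  have hceil : TendstoInMean (fun n (_ : Equiv.Perm (Fin n)) => |(⌈y * n⌉₊ : ℝ) / n - y|) 0 :=
    (TendstoInMean.of_tendsto (tendsto_natCeil_mul_div hy.1)).abs_sub
  refine TendstoInMean.squeeze
    (by simpa only [add_zero] using (hlow.abs_sub.add hceil).add hbox.abs_sub) ?_
  filter_upwards [eventually_gt_atTop 0] with n hn π
  have hgrid := jointCDF_permMeasure_div hn (runsort π)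
    #(lowRunPositions ⌈s * n⌉₊ n π) ⌈y * n⌉₊
  rw [card_lt_lowRunPositions_and_runsort_lt] at hgrid
  have hlip := (hasUniformMarginals_permMeasure hn (runsort π)).abs_jointCDF_sub_le
    (curve s) (#(lowRunPositions ⌈s * n⌉₊ n π) / n) y (⌈y * n⌉₊ / n)
  rw [hgrid] at hlip
  exact (abs_sub_le _ _ _).trans (add_le_add_left hlip _)

theorem tendstoInMean_rectDist_runsort :
    TendstoInMean (fun n (π : Equiv.Perm (Fin n)) =>
      rectDist (permMeasure (runsort π)) runsortPermuton) 0 := by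
  refine tendstoInMean_rectDist ?_ hasUniformMarginals_runsortPermuton fun x hx y hy => ?_
  · filter_upwards [eventually_gt_atTop 0] with n hn π
    exact hasUniformMarginals_permMeasure hn (runsort π)
  · obtain ⟨s, hs, rfl⟩ := exists_curve_eq hx
    exact tendstoInMean_jointCDF_runsort hs hy

theorem theorem1p1 :
    (∀ ε : ℝ, 0 < ε →
      Tendsto
        (fun n : ℕ => (PMF.uniformOfFintype (Equiv.Perm (Fin n))).toOuterMeasure
          {π | rectDist (permMeasure (runsort π)) runsortPermuton < ε})
        atTop (𝓝 1)) ∧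
    IsPermuton runsortPermuton ∧
    runsortPermuton.support =
      {p : ℝ × ℝ | p ∈ Icc (0 : ℝ) 1 ×ˢ Icc (0 : ℝ) 1 ∧ p.1 ≤ p.2 * Real.exp (1 - p.2)} := by
  refine ⟨fun ε hε => ?_, hasUniformMarginals_runsortPermuton.isPermuton,
    support_runsortPermuton⟩
  simpa only [sub_zero, abs_of_nonneg (rectDist_nonneg _ _)] using
    tendstoInMean_rectDist_runsort.tendsto_toOuterMeasure_uniformOfFintype hε
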